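/- Let $k$ be an algebraically closed field of characteristic $p\neq 2$ and let $i\in k$ with $i^2=-1$. Let $\mathfrak G$ be the Humbert cubic line complex, that is, the set of all lines in $\mathbb P^3$ that are contained in some quadric of the net $$t_1(xy+zw)+t_2(xz+yw)+t_3(xw+yz)=0,\qquad (t_1,t_2,t_3)\neq(0,0,0).$$ Regard $\mathfrak G$ as a subvariety (of dimension $3$) of $\mathbb P^5$ by means of the Klein coordinates $$(x_1,x_2,x_3,y_1,y_2,y_3)=\bigl(p_{12}+p_{34},\,-p_{13}+p_{24},\,p_{14}+p_{23},\,i(p_{34}-p_{12}),\,i(p_{24}+p_{13}),\,i(p_{23}-p_{14})\bigr),$$ where $p_{rs}=a_rb_s-a_sb_r$ are the Plücker coordinates of the line joining $a$ and $b$. Let $G\subset \mathrm{PGL}_6(k)$ be the group of projective automorphisms of $\mathfrak G$, i.e. the group of projective transformations of $\mathbb P^5$ that map $\mathfrak G$ onto itself. Then: 1. $G\cong(\mathfrak S_4\times\mathfrak S_4)\rtimes 2$, where the generator of the group of order $2$ interchanges the two factors. The isomorphism can be chosen so that $\mathfrak S_4\times\mathfrak S_4$ corresponds to the group of the transformations that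 permute $x_1,x_2,x_3$ with an even number of sign changes and permute $y_1,y_2,y_3$ with an even number of sign changes, and so that the additional generator corresponds to the projective transformation of order $2$ $$g_0:(x_1,x_2,x_3,y_1,y_2,y_3)\mapsto(-y_1,-y_2,-y_3,x_1,x_2,x_3).$$ 2. The set of singular points of $\mathfrak G$ is the disjoint union $\mathrm{Sing}(\mathfrak G)_1\cup\mathrm{Sing}(\mathfrak G)_2$. Here $\mathrm{Sing}(\mathfrak G)_1$ consists of the $18$ points with one $x_j$ equal to $1$, one $y_l$ equal to $\pm i$ and all other coordinates equal to $0$, and $\mathrm{Sing}(\mathfrak G)_2$ consists of the $16$ points $[\epsilon_1,\epsilon_2,\epsilon_3,e_1,e_2,e_3]$ with $\epsilon_j^2=-1$, $e_j^2=1$ and $\epsilon_1\epsilon_2\epsilon_3+i\,e_1e_2e_3=0$. These two sets are the orbits of $G$ on the $34$ singular points of $\mathfrak G$. 3. $\mathfrak G$ contains exactly $24$ planes of $\mathbb P^5$, and $G$ acts transitively on them. -/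

import Mathlib

open scoped LinearAlgebra.Projectivization MatrixGroups Pointwise

namespace Desmic

/-! ### Projective varieties over a field, via their points -/

section Projective

variable {k ι : Type*} [Field k]

/-- `f` vanishes on the set `X` of points of the projective space with coordinates indexed by `ι`
(`f` is evaluated at every coordinate vector of every point of `X`). -/
def VanishesOn (f : MvPolynomial ι k) (X : Set (ℙ k (ι → k))) : Prop :=
  ∀ (v : ι → k) (hv : v ≠ 0), Projectivization.mk k v hv ∈ X → MvPolynomial.eval v f = 0

/-- The tangent space at the point `P` of the affine cone over `X`: the common kernel of the
differentials at `P` of all homogeneous forms vanishing on `X`. Its dimension is one more than the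
dimension of the embedded projective tangent space of `X` at `P`. -/
def coneTangentSpace [Fintype ι] (X : Set (ℙ k (ι → k))) (P : ℙ k (ι → k)) :
    Submodule k (ι → k) where
  carrier := {w | ∀ (d : ℕ) (f : MvPolynomial ι k), f.IsHomogeneous d → VanishesOn f X →
    ∑ j, MvPolynomial.eval P.rep (MvPolynomial.pderiv j f) * w j = 0}
  zero_mem' := by
    intro d f _ _
    simp
  add_mem' := by
    intro a b ha hb d f hf hX
    simp only [Pi.add_apply, mul_add, Finset.sum_add_distrib, ha d f hf hX, hb d f hf hX, add_zero]
  smul_mem' := by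
    intro c a ha d f hf hX
    simp only [Pi.smul_apply, smul_eq_mul, mul_left_comm _ c, ← Finset.mul_sum, ha d f hf hX,
      mul_zero]

/-- The singular points of a projective variety `X` of pure dimension `n`: the points at which the
projective tangent space has dimension larger than `n`. -/
def singularPoints [Fintype ι] (n : ℕ) (X : Set (ℙ k (ι → k))) : Set (ℙ k (ι → k)) :=
  {P | P ∈ X ∧ n + 1 < Module.finrank k (coneTangentSpace X P)}

/-- The set of (projective) planes contained in `X`, a plane being viewed as a set of points. -/
def planesIn (X : Set (ℙ k (ι → k))) : Set (Set (ℙ k (ι → k))) :=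
  {E | E ⊆ X ∧ ∃ W : Submodule k (ι → k), Module.finrank k W = 3 ∧ E = {P | P.submodule ≤ W}}

/-- The group of projective automorphisms of `X`: the projective transformations that map `X` onto
itself. -/
abbrev projectiveAut [Fintype ι] [DecidableEq ι] (X : Set (ℙ k (ι → k))) : Subgroup PGL(ι, k) :=
  MulAction.stabilizer PGL(ι, k) X

end Projective

/-! ### The Humbert line complex -/

section Humbert

variable {k : Type*} [Field k]

/-- The index set of the Klein coordinates `(x₁, x₂, x₃, y₁, y₂, y₃)`; the coordinate vector is
`Sum.elim x y`. -/
abbrev KIdx : Type := Fin 3 ⊕ Fin 3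

/-- The quadrics `t₁(xy + zw) + t₂(xz + yw) + t₃(xw + yz) = 0` of the net of quadrics through the
eight vertices of two of the three tetrahedra of a desmic triple. -/
def netQuadric (t : Fin 3 → k) (v : Fin 4 → k) : k :=
  t 0 * (v 0 * v 1 + v 2 * v 3) + t 1 * (v 0 * v 2 + v 1 * v 3) + t 2 * (v 0 * v 3 + v 1 * v 2)

/-- The Plücker coordinates `p_{rs}` of the line in `ℙ³` joining the points `a` and `b`. -/
def plucker (a b : Fin 4 → k) (r s : Fin 4) : k := a r * b s - a s * b r

/-- The Klein coordinates of the line in `ℙ³` joining `a` and `b`; here `i` is a square root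
of `-1`. -/
def klein (i : k) (a b : Fin 4 → k) : KIdx → k :=
  Sum.elim
    ![plucker a b 0 1 + plucker a b 2 3,
      -plucker a b 0 2 + plucker a b 1 3,
      plucker a b 0 3 + plucker a b 1 2]
    ![i * (plucker a b 2 3 - plucker a b 0 1),
      i * (plucker a b 1 3 + plucker a b 0 2),
      i * (plucker a b 1 2 - plucker a b 0 3)]

/-- The Humbert cubic line complex in Klein coordinates: the set of all lines `⟨a, b⟩` of `ℙ³`
that are contained in some quadric of the net. -/
def humbertComplex (i : k) : Set (ℙ k (KIdx → k)) :=
  {P | ∃ a b : Fin 4 → k, LinearIndependent k ![a, b] ∧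
    (∃ t : Fin 3 → k, t ≠ 0 ∧ ∀ r s : k, netQuadric t (r • a + s • b) = 0) ∧
    P.submodule = Submodule.span k {klein i a b}}

/-- The points `[1,0,0,±i,0,0], …, [0,0,1,0,0,±i]`: one of the `xⱼ` is `1`, one of the `yₗ` is a
square root of `-1`, all other coordinates are `0`. -/
def sing₁ (k : Type*) [Field k] : Set (ℙ k (KIdx → k)) :=
  {P | ∃ (j l : Fin 3) (c : k), c ^ 2 = -1 ∧
    P.submodule = Submodule.span k {Sum.elim (Pi.single j (1 : k)) (Pi.single l c)}}

/-- The points `[ε₁,ε₂,ε₃,e₁,e₂,e₃]` with `εⱼ² = -1`, `eⱼ² = 1` and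
`ε₁ε₂ε₃ + i e₁e₂e₃ = 0`. -/
def sing₂ (i : k) : Set (ℙ k (KIdx → k)) :=
  {P | ∃ ε e : Fin 3 → k, (∀ j, ε j ^ 2 = -1) ∧ (∀ j, e j ^ 2 = 1) ∧
    ε 0 * ε 1 * ε 2 + i * (e 0 * e 1 * e 2) = 0 ∧
    P.submodule = Submodule.span k {Sum.elim ε e}}

/-- The linear transformation `(x, y) ↦ (-y, x)`. -/
def g₀ (k : Type*) [Field k] : GL KIdx k where
  val := Matrix.fromBlocks 0 (-1) 1 0
  inv := Matrix.fromBlocks 0 1 (-1) 0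
  val_inv := by simp [Matrix.fromBlocks_multiply]
  inv_val := by simp [Matrix.fromBlocks_multiply]

theorem g₀_smul (x y : Fin 3 → k) : g₀ k • (Sum.elim x y : KIdx → k) = Sum.elim (-y) x := by
  change Matrix.mulVec (Matrix.fromBlocks 0 (-1) 1 0) (Sum.elim x y) = _
  simp [Matrix.fromBlocks_mulVec, Matrix.neg_mulVec]

/-- The obvious projective symmetries in Klein coordinates: permutations of the `xⱼ` with an even
number of sign changes, combined with permutations of the `yⱼ` with an even number of sign
changes. -/
def obviousSymmetries (k : Type*) [Field k] : Set PGL(KIdx, k) :=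
  {γ | ∃ (g : GL KIdx k) (σ τ : Equiv.Perm (Fin 3)) (ε e : Fin 3 → ℤˣ),
    ∏ j, ε j = 1 ∧ ∏ j, e j = 1 ∧
    (∀ x y : Fin 3 → k, g • (Sum.elim x y : KIdx → k) =
      Sum.elim (fun j => ((ε j : ℤ) : k) * x (σ j)) (fun j => ((e j : ℤ) : k) * y (τ j))) ∧
    γ = Matrix.ProjGenLinGroup.mk g}

end Humbert

/-- The action of the group of order two on `H × H` whose generator interchanges the factors. -/
def swapAction (H : Type*) [Group H] : Multiplicative (ZMod 2) →* MulAut (H × H) where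
  toFun z := if z = 1 then 1 else (MulEquiv.prodComm : H × H ≃* H × H)
  map_one' := by simp
  map_mul' := by
    have hsq : (MulEquiv.prodComm : H × H ≃* H × H) * (MulEquiv.prodComm : H × H ≃* H × H)
        = (1 : MulAut (H × H)) := by
      ext x <;> rfl
    have h : ∀ z : Multiplicative (ZMod 2), z = 1 ∨ z = Multiplicative.ofAdd 1 := by decide
    have h1 : (Multiplicative.ofAdd 1 : Multiplicative (ZMod 2)) ≠ 1 := by decide
    have h2 : (Multiplicative.ofAdd 1 * Multiplicative.ofAdd 1 : Multiplicative (ZMod 2)) = 1 := by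
      decide
    intro a b
    rcases h a with rfl | rfl <;> rcases h b with rfl | rfl
    · simp
    · rw [one_mul, if_pos rfl, one_mul]
    · rw [mul_one, if_pos rfl, mul_one]
    · rw [h2, if_pos rfl, if_neg h1]
      exact hsq.symm

end Desmic

/-!
In the coordinates `(x, z)` with `z = i y` the Humbert complex is cut out by `∑ xⱼ² = ∑ zⱼ²` and
`∏ xⱼ = ∏ zⱼ`. A plane in it is maximal isotropic for the quadric, and the cubic equation restricted
to it forces each `zⱼ` to be proportional to a coordinate `xₗ`, so the plane is the graph
`z = s x` of a permutation with an even number of sign changes. These signed permutations are the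
rotations of a regular tetrahedron and its reflections through planes of symmetry, so `s` runs
through the symmetric group on the vertices `v₀, …, v₃`.

A projective automorphism permutes these `24` planes. The points lying on at least six of them are
the sixteen points `(vₐ, v_b)`, which are therefore permuted as well. Two distinct ones lie on a
common plane if and only if they are in different rows and different columns of the `4 × 4` grid, so
the permutation preserves rows and columns or interchanges them, and a linear map that does this is
a scalar multiple of a pair of elements of the tetrahedral representation, composed with `x ↔ z` in
the second case.

At a singular point the gradients of the quadric and the cubic are proportional, since the tangent
space of the cone has dimension at least `5`; solving the resulting equations gives the pairs of
vertices `(vₐ, v_b)` and the sums of two vertices `(vₐ + v_b, v_c + v_d)`. Conversely, three of the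
planes through such a point span a space of dimension `5`, which is contained in the tangent space
of the cone.
-/

namespace Desmic

/-! ### The tetrahedral representation of the symmetric group on four letters -/

section Tetrahedral

open Equiv

/-- The vertices of a regular tetrahedron centred at the origin, with integral coordinates. -/
def vertexSign : Fin 4 → Fin 3 → ℤ := ![![1, 1, 1], ![1, -1, -1], ![-1, 1, -1], ![-1, -1, 1]]

theorem sum_vertexSign : ∀ j, ∑ a, vertexSign a j = 0 := by decide

theorem vertexSign_dotProduct :
    ∀ a b, vertexSign a ⬝ᵥ vertexSign b = (if a = b then 4 else 0) - 1 := by decide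

theorem sum_vertexSign_mul_vertexSign :
    ∀ j l, ∑ a, vertexSign a j * vertexSign a l = 4 * if j = l then 1 else 0 := by decide

theorem exists_perm_of_signedPerm : ∀ (σ : Perm (Fin 3)) (ε : Fin 3 → ℤˣ), ∏ j, ε j = 1 →
    ∃ s : Perm (Fin 4), ∀ a j, (ε j : ℤ) * vertexSign a (σ j) = vertexSign (s a) j := by
  decide +kernel

theorem exists_signedPerm_of_perm : ∀ s : Perm (Fin 4), ∃ (σ : Perm (Fin 3)) (ε : Fin 3 → ℤˣ),
    ∏ j, ε j = 1 ∧ ∀ a j, (ε j : ℤ) * vertexSign a (σ j) = vertexSign (s a) j := by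
  decide +kernel

/-- The vertices of a regular tetrahedron centred at the origin, as vectors over `k`. -/
def vertex (k : Type*) [Field k] (a : Fin 4) : Fin 3 → k := fun j => (vertexSign a j : k)

/-- The matrix that maps the vertex `a` of the tetrahedron to the vertex `s a`; it is built from
the identity `∑ₐ vₐ vₐᵀ = 4`. -/
def tetMatrix (k : Type*) [Field k] (s : Perm (Fin 4)) : Matrix (Fin 3) (Fin 3) k :=
  (4 : k)⁻¹ • ∑ a, Matrix.vecMulVec (vertex k (s a)) (vertex k a)

variable {k : Type*} [Field k]

theorem sum_vertex : ∑ a, vertex k a = 0 := by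
  ext j
  simpa [vertex] using congrArg (Int.cast : ℤ → k) (sum_vertexSign j)

theorem vertex_dotProduct (a b : Fin 4) :
    vertex k a ⬝ᵥ vertex k b = (if a = b then 4 else 0) - 1 := by
  simpa [vertex, dotProduct] using congrArg (Int.cast : ℤ → k) (vertexSign_dotProduct a b)

theorem sum_vertex_mul_vertex (j l : Fin 3) :
    ∑ a, vertex k a j * vertex k a l = 4 * if j = l then 1 else 0 := by
  simpa [vertex] using congrArg (Int.cast : ℤ → k) (sum_vertexSign_mul_vertexSign j l)

theorem sum_vecMulVec_vertex :
    ∑ a, Matrix.vecMulVec (vertex k a) (vertex k a) = (4 : k) • 1 := by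
  ext j l
  simp only [Matrix.sum_apply, Matrix.vecMulVec_apply, sum_vertex_mul_vertex, Matrix.smul_apply,
    Matrix.one_apply, smul_eq_mul]

theorem vertex_apply_mul_self (a : Fin 4) (j : Fin 3) : vertex k a j * vertex k a j = 1 := by
  have h : ∀ a j, vertexSign a j * vertexSign a j = 1 := by decide
  simpa [vertex] using congrArg (Int.cast : ℤ → k) (h a j)

theorem vertex_ne_zero (a : Fin 4) : vertex k a ≠ 0 := fun h => by
  simpa [h] using vertex_apply_mul_self (k := k) a 0

variable [NeZero (2 : k)]

theorem four_ne_zero_of_two : (4 : k) ≠ 0 := by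
  rw [← two_add_two_eq_four, ← two_mul]
  exact mul_ne_zero two_ne_zero two_ne_zero

theorem eq_sum_vertex (u : Fin 3 → k) :
    u = (4 : k)⁻¹ • ∑ a, (vertex k a ⬝ᵥ u) • vertex k a := by
  have h := congrArg (Matrix.mulVec · u) (sum_vecMulVec_vertex (k := k))
  simp only [Matrix.sum_mulVec, Matrix.vecMulVec_mulVec, op_smul_eq_smul, Matrix.smul_mulVec,
    Matrix.one_mulVec] at h
  rw [h, inv_smul_smul₀ four_ne_zero_of_two]

theorem linearMap_ext_vertex {M : Type*} [AddCommGroup M] [Module k M]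
    {f g : (Fin 3 → k) →ₗ[k] M} (h : ∀ a, f (vertex k a) = g (vertex k a)) : f = g := by
  refine LinearMap.ext fun u => ?_
  rw [eq_sum_vertex (k := k) u]
  simp only [map_smul, map_sum, h]

theorem matrix_ext_vertex {M N : Matrix (Fin 3) (Fin 3) k}
    (h : ∀ a, M.mulVec (vertex k a) = N.mulVec (vertex k a)) : M = N :=
  Matrix.toLin'.injective (linearMap_ext_vertex (by simpa using h))

theorem eq_zero_of_smul_vertex_eq_smul_vertex {a b : Fin 4} (hab : a ≠ b) {c d : k}
    (h : c • vertex k a = d • vertex k b) : c = 0 := by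
  have ha := congrArg (vertex k a ⬝ᵥ ·) h
  have hb := congrArg (vertex k b ⬝ᵥ ·) h
  simp only [dotProduct_smul, vertex_dotProduct, if_pos, if_neg hab, if_neg hab.symm,
    smul_eq_mul] at ha hb
  have : 4 * 2 * c = 0 := by linear_combination 3 * ha + hb
  exact (mul_eq_zero.mp this).resolve_left (mul_ne_zero four_ne_zero_of_two two_ne_zero)

theorem vertex_injective : Function.Injective (vertex k) := fun a b h => by
  by_contra hab
  exact one_ne_zero (eq_zero_of_smul_vertex_eq_smul_vertex hab (congrArg ((1 : k) • ·) h))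

theorem tetMatrix_mulVec_vertex (s : Perm (Fin 4)) (a : Fin 4) :
    (tetMatrix k s).mulVec (vertex k a) = vertex k (s a) := by
  simp only [tetMatrix, Matrix.smul_mulVec, Matrix.sum_mulVec, Matrix.vecMulVec_mulVec,
    vertex_dotProduct, op_smul_eq_smul, sub_smul, one_smul, ite_smul, zero_smul,
    Finset.sum_sub_distrib, Equiv.sum_comp s (vertex k), sum_vertex, Finset.sum_ite_eq',
    Finset.mem_univ, if_true, sub_zero]
  exact inv_smul_smul₀ four_ne_zero_of_two _

/-- The tetrahedral representation of the symmetric group on four letters. -/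
def tet (k : Type*) [Field k] [NeZero (2 : k)] : Perm (Fin 4) →* Matrix (Fin 3) (Fin 3) k where
  toFun := tetMatrix k
  map_one' := matrix_ext_vertex fun a => by simp [tetMatrix_mulVec_vertex]
  map_mul' s t := matrix_ext_vertex fun a => by
    simp [tetMatrix_mulVec_vertex, ← Matrix.mulVec_mulVec]

@[simp]
theorem tet_mulVec_vertex (s : Perm (Fin 4)) (a : Fin 4) :
    (tet k s).mulVec (vertex k a) = vertex k (s a) := tetMatrix_mulVec_vertex s a

theorem tet_mulVec_mulVec (s t : Perm (Fin 4)) (u : Fin 3 → k) :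
    (tet k s).mulVec ((tet k t).mulVec u) = (tet k (s * t)).mulVec u := by
  rw [Matrix.mulVec_mulVec, map_mul]

theorem eq_tet_inv_mulVec_iff {s : Perm (Fin 4)} {u v : Fin 3 → k} :
    u = (tet k s⁻¹).mulVec v ↔ (tet k s).mulVec u = v := by
  constructor <;> rintro rfl <;>
    simp only [tet_mulVec_mulVec, mul_inv_cancel, inv_mul_cancel, map_one, Matrix.one_mulVec]

theorem tet_mulVec_eq_signedPerm {s : Perm (Fin 4)} {σ : Perm (Fin 3)} {ε : Fin 3 → ℤˣ}
    (h : ∀ a j, (ε j : ℤ) * vertexSign a (σ j) = vertexSign (s a) j) (u : Fin 3 → k) :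
    (tet k s).mulVec u = fun j => ((ε j : ℤ) : k) * u (σ j) := by
  have : (tet k s).mulVecLin =
      LinearMap.pi fun j => ((ε j : ℤ) : k) • LinearMap.proj (σ j) :=
    linearMap_ext_vertex fun a => by
      ext j
      simp only [Matrix.mulVecLin_apply, tet_mulVec_vertex, LinearMap.pi_apply,
        LinearMap.smul_apply, LinearMap.proj_apply, smul_eq_mul, vertex, ← h, Int.cast_mul]
  exact LinearMap.congr_fun this u

theorem tet_mulVec_dotProduct_tet_mulVec (s : Perm (Fin 4)) (u v : Fin 3 → k) :
    (tet k s).mulVec u ⬝ᵥ (tet k s).mulVec v = u ⬝ᵥ v := by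
  obtain ⟨σ, ε, -, h⟩ := exists_signedPerm_of_perm s
  have hε (j : Fin 3) : ((ε j : ℤ) : k) * ((ε j : ℤ) : k) = 1 := by
    exact_mod_cast congrArg (Int.cast : ℤ → k) (Int.units_coe_mul_self (ε j))
  simp only [tet_mulVec_eq_signedPerm h, dotProduct, mul_mul_mul_comm, hε, one_mul]
  exact Equiv.sum_comp σ fun j => u j * v j

theorem prod_tet_mulVec (s : Perm (Fin 4)) (u : Fin 3 → k) :
    ∏ j, (tet k s).mulVec u j = ∏ j, u j := by
  obtain ⟨σ, ε, hε, h⟩ := exists_signedPerm_of_perm s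
  have hε' : ∏ j, ((ε j : ℤ) : k) = 1 := by
    exact_mod_cast congrArg (fun e : ℤˣ => ((e : ℤ) : k)) hε
  rw [tet_mulVec_eq_signedPerm h, Finset.prod_mul_distrib, hε', one_mul, Equiv.prod_comp σ u]

theorem vertex_dotProduct_tet_mulVec (s : Perm (Fin 4)) (a : Fin 4) (u : Fin 3 → k) :
    vertex k (s a) ⬝ᵥ (tet k s).mulVec u = vertex k a ⬝ᵥ u := by
  rw [← tet_mulVec_vertex, tet_mulVec_dotProduct_tet_mulVec]

end Tetrahedral

/-! ### Equations of the Humbert complex -/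

section Equations

/-- The space of coordinates `(x, z)`, where `z = i y`. The complex becomes defined over the prime
field in these coordinates and `x`, `z` play symmetric roles. -/
abbrev Pair (k : Type*) : Type _ := (Fin 3 → k) × (Fin 3 → k)

variable {k : Type*} [Field k]

/-- The equations of the Humbert complex in the coordinates `(x, z)`: the Klein quadric and a
cubic. -/
def HumbertEqs (p : Pair k) : Prop :=
  p.1 ⬝ᵥ p.1 = p.2 ⬝ᵥ p.2 ∧ ∏ j, p.1 j = ∏ j, p.2 j

theorem HumbertEqs.smul {p : Pair k} (h : HumbertEqs p) (c : k) : HumbertEqs (c • p) := by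
  simp only [HumbertEqs, Prod.smul_fst, Prod.smul_snd, smul_dotProduct, dotProduct_smul, h.1,
    Pi.smul_apply, smul_eq_mul, Finset.prod_mul_distrib, h.2, and_self]

/-- The coordinate change from `(x, z)` to the Klein coordinates `(x, y)`; note `y = -i z`. -/
def kleinEquiv {i : k} (hi : i ^ 2 = -1) : Pair k ≃ₗ[k] (KIdx → k) where
  toFun p := Sum.elim p.1 (-i • p.2)
  invFun v := (fun j => v (Sum.inl j), fun j => i * v (Sum.inr j))
  map_add' p q := by ext (j | j) <;> simp
  map_smul' c p := by ext (j | j) <;> simp [mul_left_comm]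
  left_inv p := by
    ext j
    · simp
    · simp only [Sum.elim_inr, Pi.smul_apply, smul_eq_mul]
      linear_combination (-p.2 j) * hi
  right_inv v := by
    ext (j | j)
    · simp
    · simp only [Sum.elim_inr, Pi.smul_apply, smul_eq_mul]
      linear_combination (-v (Sum.inr j)) * hi

theorem kleinEquiv_apply {i : k} (hi : i ^ 2 = -1) (p : Pair k) :
    kleinEquiv hi p = Sum.elim p.1 (-i • p.2) := rfl

theorem kleinEquiv_symm_klein {i : k} (hi : i ^ 2 = -1) (a b : Fin 4 → k) :
    (kleinEquiv hi).symm (klein i a b) =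
      (![plucker a b 0 1 + plucker a b 2 3, -plucker a b 0 2 + plucker a b 1 3,
        plucker a b 0 3 + plucker a b 1 2],
      ![plucker a b 0 1 - plucker a b 2 3, -plucker a b 0 2 - plucker a b 1 3,
        plucker a b 0 3 - plucker a b 1 2]) := by
  rw [LinearEquiv.symm_apply_eq, kleinEquiv_apply]
  ext (j | j) <;> fin_cases j <;> simp [klein] <;> ring

theorem klein_smul_add_smul_left (i : k) (a b : Fin 4 → k) (c d : k) :
    klein i (c • a + d • b) b = c • klein i a b := by
  ext (j | j) <;> fin_cases j <;> simp [klein, plucker] <;> ring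

theorem klein_smul_add_smul_right (i : k) (a b : Fin 4 → k) (c d : k) :
    klein i a (c • a + d • b) = d • klein i a b := by
  ext (j | j) <;> fin_cases j <;> simp [klein, plucker] <;> ring

theorem linearIndependent_of_klein_ne_zero {i : k} {a b : Fin 4 → k} (h : klein i a b ≠ 0) :
    LinearIndependent k ![a, b] := by
  have klein_zero_left (v : Fin 4 → k) : klein i 0 v = 0 := by
    simpa using klein_smul_add_smul_left i v v 0 0
  have klein_zero_right (v : Fin 4 → k) : klein i v 0 = 0 := by
    simpa using klein_smul_add_smul_right i v v 0 0
  rw [LinearIndependent.pair_iff]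
  intro c d hcd
  have hc := klein_smul_add_smul_left i a b c d
  have hd := klein_smul_add_smul_right i a b c d
  rw [hcd, klein_zero_left, eq_comm, smul_eq_zero_iff_left h] at hc
  rw [hcd, klein_zero_right, eq_comm, smul_eq_zero_iff_left h] at hd
  exact ⟨hc, hd⟩

/-- The matrix of the linear conditions on `t` for the line `⟨a, b⟩` to lie on the quadric of the
net with parameter `t`; the rows are the coefficients of `r²`, `rs` and `s²` in
`netQuadric t (r • a + s • b)`. -/
def netMatrix (a b : Fin 4 → k) : Matrix (Fin 3) (Fin 3) k :=
  !![a 0 * a 1 + a 2 * a 3, a 0 * a 2 + a 1 * a 3, a 0 * a 3 + a 1 * a 2;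
    a 0 * b 1 + a 1 * b 0 + (a 2 * b 3 + a 3 * b 2),
    a 0 * b 2 + a 2 * b 0 + (a 1 * b 3 + a 3 * b 1),
    a 0 * b 3 + a 3 * b 0 + (a 1 * b 2 + a 2 * b 1);
    b 0 * b 1 + b 2 * b 3, b 0 * b 2 + b 1 * b 3, b 0 * b 3 + b 1 * b 2]

theorem netQuadric_smul_add_smul (a b : Fin 4 → k) (t : Fin 3 → k) (r s : k) :
    netQuadric t (r • a + s • b) = r ^ 2 * (netMatrix a b).mulVec t 0 +
      r * s * (netMatrix a b).mulVec t 1 + s ^ 2 * (netMatrix a b).mulVec t 2 := by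
  simp [netQuadric, netMatrix, Matrix.mulVec, dotProduct, Fin.sum_univ_three]
  ring

theorem netMatrix_mulVec_eq_zero_iff (a b : Fin 4 → k) (t : Fin 3 → k) :
    (netMatrix a b).mulVec t = 0 ↔ ∀ r s : k, netQuadric t (r • a + s • b) = 0 := by
  simp only [netQuadric_smul_add_smul]
  refine ⟨fun h r s => by simp [h], fun h => ?_⟩
  have h0 : (netMatrix a b).mulVec t 0 = 0 := by simpa using h 1 0
  have h2 : (netMatrix a b).mulVec t 2 = 0 := by simpa using h 0 1
  have h1 : (netMatrix a b).mulVec t 1 = 0 := by simpa [h0, h2] using h 1 1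
  ext j
  fin_cases j
  exacts [h0, h1, h2]

theorem exists_netQuadric_line_iff (a b : Fin 4 → k) :
    (∃ t : Fin 3 → k, t ≠ 0 ∧ ∀ r s : k, netQuadric t (r • a + s • b) = 0) ↔
      (netMatrix a b).det = 0 := by
  simp only [← netMatrix_mulVec_eq_zero_iff, Matrix.exists_mulVec_eq_zero_iff]

variable [NeZero (2 : k)]

theorem humbertEqs_kleinEquiv_symm_klein_iff {i : k} (hi : i ^ 2 = -1) (a b : Fin 4 → k) :
    HumbertEqs ((kleinEquiv hi).symm (klein i a b)) ↔ (netMatrix a b).det = 0 := by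
  set p := (kleinEquiv hi).symm (klein i a b) with hp
  have quadric : p.1 ⬝ᵥ p.1 = p.2 ⬝ᵥ p.2 := by
    simp only [hp, kleinEquiv_symm_klein, dotProduct, Fin.sum_univ_three, Matrix.cons_val, plucker]
    ring
  have cubic : ∏ j, p.1 j - ∏ j, p.2 j = -2 * (netMatrix a b).det := by
    simp only [hp, kleinEquiv_symm_klein, Fin.prod_univ_three, Matrix.cons_val, plucker,
      Matrix.det_fin_three, netMatrix, Matrix.of_apply]
    ring
  rw [HumbertEqs, and_iff_right quadric, ← sub_eq_zero, cubic,
    mul_eq_zero_iff_left (neg_ne_zero.mpr two_ne_zero)]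

/-- Twice the matrix of the Plücker coordinates `p_{rs}`, in terms of the coordinates `(x, z)`. The
rows of the matrix of the Plücker coordinates of a line are points of this line. -/
def pluckerMatrix (p : Pair k) : Matrix (Fin 4) (Fin 4) k :=
  !![0, p.1 0 + p.2 0, -(p.1 1 + p.2 1), p.1 2 + p.2 2;
    -(p.1 0 + p.2 0), 0, p.1 2 - p.2 2, p.1 1 - p.2 1;
    p.1 1 + p.2 1, -(p.1 2 - p.2 2), 0, p.1 0 - p.2 0;
    -(p.1 2 + p.2 2), -(p.1 1 - p.2 1), -(p.1 0 - p.2 0), 0]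

omit [NeZero (2 : k)] in
theorem klein_pluckerMatrix {i : k} (hi : i ^ 2 = -1) {p : Pair k}
    (h : p.1 ⬝ᵥ p.1 = p.2 ⬝ᵥ p.2) (r s : Fin 4) :
    klein i (pluckerMatrix p r) (pluckerMatrix p s) =
      (2 * pluckerMatrix p r s) • kleinEquiv hi p := by
  simp only [dotProduct, Fin.sum_univ_three] at h
  rw [← map_smul, ← LinearEquiv.symm_apply_eq, kleinEquiv_symm_klein]
  ext j <;> fin_cases j <;> fin_cases r <;> fin_cases s <;>
    simp only [Fin.zero_eta, Fin.mk_one, Fin.reduceFinMk, plucker, pluckerMatrix, Matrix.of_apply,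
      Matrix.cons_val, Prod.smul_fst, Prod.smul_snd, Pi.smul_apply, smul_eq_mul] <;>
    first
    | ring1
    | linear_combination h
    | linear_combination -h

theorem exists_pluckerMatrix_ne_zero {p : Pair k} (h : p ≠ 0) : ∃ r s, pluckerMatrix p r s ≠ 0 := by
  contrapose! h
  have eq_zero_of_add_of_sub {a b : k} (hadd : a + b = 0) (hsub : a - b = 0) : a = 0 ∧ b = 0 := by
    have ha : 2 * a = 0 := by linear_combination hadd + hsub
    have hb : 2 * b = 0 := by linear_combination hadd - hsub
    simpa [two_ne_zero] using And.intro ha hb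
  obtain ⟨hx0, hz0⟩ := eq_zero_of_add_of_sub (h 0 1) (h 2 3)
  obtain ⟨hx1, hz1⟩ := eq_zero_of_add_of_sub (h 2 0) (h 1 3)
  obtain ⟨hx2, hz2⟩ := eq_zero_of_add_of_sub (h 0 3) (h 1 2)
  ext j <;> fin_cases j
  exacts [hx0, hx1, hx2, hz0, hz1, hz2]

theorem mk_mem_humbertComplex_iff {i : k} (hi : i ^ 2 = -1) (p : Pair k)
    (hp : kleinEquiv hi p ≠ 0) :
    Projectivization.mk k (kleinEquiv hi p) hp ∈ humbertComplex i ↔ HumbertEqs p := by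
  simp only [humbertComplex, Set.mem_ofPred_eq, Projectivization.submodule_mk,
    exists_netQuadric_line_iff, ← humbertEqs_kleinEquiv_symm_klein_iff hi]
  constructor
  · rintro ⟨a, b, -, hab, hspan⟩
    obtain ⟨c, hc⟩ := Submodule.mem_span_singleton.mp
      (hspan ▸ Submodule.mem_span_singleton_self (kleinEquiv hi p))
    rw [← (kleinEquiv hi).symm_apply_apply p, ← hc, map_smul]
    exact hab.smul c
  · intro h
    obtain ⟨r, s, hrs⟩ := exists_pluckerMatrix_ne_zero ((kleinEquiv hi).map_ne_zero_iff.mp hp)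
    have hklein := klein_pluckerMatrix hi h.1 r s
    have hc : 2 * pluckerMatrix p r s ≠ 0 := mul_ne_zero two_ne_zero hrs
    refine ⟨pluckerMatrix p r, pluckerMatrix p s, ?_, ?_, ?_⟩
    · refine linearIndependent_of_klein_ne_zero (i := i) ?_
      rw [hklein]
      exact smul_ne_zero hc hp
    · rw [hklein, map_smul, LinearEquiv.symm_apply_apply]
      exact h.smul _
    · rw [hklein, Submodule.span_singleton_smul_eq (isUnit_iff_ne_zero.mpr hc)]

end Equations

/-! ### Planes in the Humbert complex -/

section Lagrangian

variable {k ι : Type*} [Field k]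

theorem exists_eq_smul_of_prod_eq_zero [Infinite k] [Fintype ι] {V : Type*} [AddCommGroup V]
    [Module k V] {x : ι → V →ₗ[k] k} {z : V →ₗ[k] k} (h : ∀ v, z v = 0 → ∏ j, x j v = 0) :
    ∃ (j : ι) (c : k), x j = c • z := by
  have hcover : ⋃ j, (((x j).domRestrict z.ker).ker : Set z.ker) = Set.univ := by
    refine Set.eq_univ_of_forall fun v => Set.mem_iUnion.mpr ?_
    obtain ⟨j, -, hj⟩ := Finset.prod_eq_zero_iff.mp (h v v.2)
    exact ⟨j, hj⟩
  obtain ⟨j, hj⟩ := Subspace.exists_eq_top_of_iUnion_eq_univ hcover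
  have hker : ⨅ _ : Unit, z.ker ≤ (x j).ker := by
    rw [iInf_const]
    intro v hv
    exact (hj ▸ Submodule.mem_top : (⟨v, hv⟩ : z.ker) ∈ ((x j).domRestrict z.ker).ker)
  obtain ⟨c, hc⟩ := Submodule.mem_span_singleton.mp
    (by simpa using mem_span_of_iInf_ker_le_ker hker : x j ∈ Submodule.span k {z})
  exact ⟨j, c, hc.symm⟩

variable [Fintype ι]

/-- The symmetric bilinear form of the quadric `∑ xⱼ² = ∑ zⱼ²`. -/
def polarForm (k ι : Type*) [Field k] [Fintype ι] :
    LinearMap.BilinForm k ((ι → k) × (ι → k)) :=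
  LinearMap.mk₂ k (fun p q => p.1 ⬝ᵥ q.1 - p.2 ⬝ᵥ q.2)
    (fun p p' q => by simp only [Prod.fst_add, Prod.snd_add, add_dotProduct]; ring)
    (fun c p q => by simp [mul_sub])
    (fun p q q' => by simp only [Prod.fst_add, Prod.snd_add, dotProduct_add]; ring)
    (fun c p q => by simp [mul_sub])

theorem polarForm_apply (p q : (ι → k) × (ι → k)) :
    polarForm k ι p q = p.1 ⬝ᵥ q.1 - p.2 ⬝ᵥ q.2 := rfl

theorem polarForm_comm (p q : (ι → k) × (ι → k)) : polarForm k ι p q = polarForm k ι q p := by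
  simp only [polarForm_apply, dotProduct_comm]

theorem polarForm_nondegenerate : (polarForm k ι).Nondegenerate := by
  classical
  have h : ∀ p, (∀ q, polarForm k ι p q = 0) → p = 0 := by
    intro p hp
    ext j
    · simpa [polarForm_apply] using hp (Pi.single j 1, 0)
    · simpa [polarForm_apply] using hp (0, Pi.single j 1)
  exact ⟨h, fun q hq => h q fun p => (polarForm_comm q p).trans (hq p)⟩

variable [NeZero (2 : k)] {W : Submodule k ((ι → k) × (ι → k))}

theorem orthogonal_eq_self (hfin : Module.finrank k W = Fintype.card ι)
    (hW : ∀ p ∈ W, polarForm k ι p p = 0) : (polarForm k ι).orthogonal W = W := by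
  symm
  apply Submodule.eq_of_le_of_finrank_eq
  · intro q hq p hp
    have h := hW _ (W.add_mem hp hq)
    simp only [map_add, LinearMap.add_apply, hW p hp, hW q hq, zero_add, add_zero] at h
    rw [polarForm_comm q p, ← two_mul] at h
    exact (mul_eq_zero.mp h).resolve_left two_ne_zero
  · rw [LinearMap.BilinForm.finrank_orthogonal polarForm_nondegenerate, hfin]
    simp

theorem prod_units_eq_one {ε : ι → ℤˣ} (h : ∏ j, ((ε j : ℤ) : k) = 1) : ∏ j, ε j = 1 := by
  rcases Int.units_eq_one_or (∏ j, ε j) with h1 | h1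
  · exact h1
  · have hcast : ((∏ j, ε j : ℤˣ) : ℤ) = (1 : k) := by simpa [Units.coe_prod] using h
    have : (-1 : k) = 1 := by simpa [h1] using hcast
    exact absurd (by linear_combination -this) (two_ne_zero (α := k))

/-- On `W` each `zₗ` divides `∏ xⱼ`, so it is proportional to some `xⱼ`, say `x_{σ l} = cₗ zₗ`. Then
`(e_{σ l}, cₗ eₗ)` is orthogonal to `W`, hence lies in `W`; the rest follows by evaluating the
equations at these vectors. -/
theorem exists_signedPerm_of_orthogonal_eq_self [Infinite k]
    (horth : (polarForm k ι).orthogonal W = W) (hprod : ∀ p ∈ W, ∏ j, p.1 j = ∏ j, p.2 j) :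
    ∃ (σ : Equiv.Perm ι) (ε : ι → ℤˣ), ∏ j, ε j = 1 ∧
      ∀ p ∈ W, ∀ l, p.2 l = ((ε l : ℤ) : k) * p.1 (σ l) := by
  classical
  have hforms (l : ι) : ∃ (j : ι) (c : k), ∀ p ∈ W, p.1 j = c * p.2 l := by
    obtain ⟨j, c, h⟩ := exists_eq_smul_of_prod_eq_zero
      (x := fun j => LinearMap.proj j ∘ₗ LinearMap.fst k _ _ ∘ₗ W.subtype)
      (z := LinearMap.proj l ∘ₗ LinearMap.snd k _ _ ∘ₗ W.subtype)
      fun w hw => (hprod w w.2).trans (Finset.prod_eq_zero (Finset.mem_univ l) hw)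
    exact ⟨j, c, fun p hp => LinearMap.congr_fun h ⟨p, hp⟩⟩
  choose σ c h using hforms
  have hmem (l : ι) : (Pi.single (σ l) 1, Pi.single l (c l)) ∈ W := by
    rw [← horth]
    intro p hp
    simp [polarForm_apply, h l p hp, mul_comm]
  have hsq (l : ι) : c l * c l = 1 := by simpa using (h l _ (hmem l)).symm
  have hinj : Function.Injective σ := by
    intro l m hlm
    by_contra hne
    simpa [hlm, hne] using h l _ (hmem m)
  let σ' : Equiv.Perm ι := Equiv.ofBijective σ (Finite.injective_iff_bijective.mp hinj)
  have hc : ∏ l, c l = 1 := by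
    have h1 := hprod _ (W.sum_mem (t := Finset.univ) fun l _ => hmem l)
    simp only [Prod.fst_sum, Prod.snd_sum, Finset.univ_sum_single] at h1
    rw [← h1, ← Equiv.sum_comp σ'.symm]
    simp [σ', Equiv.ofBijective_apply_symm_apply σ]
  have hunit (l : ι) : ∃ e : ℤˣ, ((e : ℤ) : k) = c l := by
    rcases mul_self_eq_one_iff.mp (hsq l) with hl | hl
    · exact ⟨1, by simp [hl]⟩
    · exact ⟨-1, by simp [hl]⟩
  choose ε hε using hunit
  refine ⟨σ', ε, prod_units_eq_one (k := k) (by simpa only [hε] using hc), fun p hp l => ?_⟩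
  rw [hε, Equiv.ofBijective_apply, h l p hp, ← mul_assoc, hsq, one_mul]

end Lagrangian

section Planes

open Equiv

variable {k : Type*} [Field k] [NeZero (2 : k)]

/-- The graph of an element of the tetrahedral representation; these are the planes in the Humbert
complex. -/
def graphPlane (k : Type*) [Field k] [NeZero (2 : k)] (s : Perm (Fin 4)) : Submodule k (Pair k) :=
  (tet k s).mulVecLin.graph

theorem mem_graphPlane {s : Perm (Fin 4)} {p : Pair k} :
    p ∈ graphPlane k s ↔ p.2 = (tet k s).mulVec p.1 := by
  simp [graphPlane, LinearMap.mem_graph_iff]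

theorem finrank_graphPlane (s : Perm (Fin 4)) : Module.finrank k (graphPlane k s) = 3 := by
  rw [graphPlane, LinearMap.graph_eq_range_prod, LinearMap.finrank_range_of_inj]
  · simp
  · exact fun u v h => congrArg Prod.fst h

theorem vertex_pair_mem_graphPlane {s : Perm (Fin 4)} {a b : Fin 4} :
    (vertex k a, vertex k b) ∈ graphPlane k s ↔ s a = b := by
  rw [mem_graphPlane, tet_mulVec_vertex, vertex_injective.eq_iff, eq_comm]

theorem graphPlane_injective : Function.Injective (graphPlane k) := fun s t h =>
  Equiv.ext fun a => (vertex_pair_mem_graphPlane.mp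
    (h ▸ vertex_pair_mem_graphPlane.mpr rfl : (vertex k a, vertex k (s a)) ∈ graphPlane k t)).symm

theorem humbertEqs_of_mem_graphPlane {s : Perm (Fin 4)} {p : Pair k} (hp : p ∈ graphPlane k s) :
    HumbertEqs p := by
  rw [HumbertEqs, mem_graphPlane.mp hp, tet_mulVec_dotProduct_tet_mulVec, prod_tet_mulVec]
  exact ⟨rfl, rfl⟩

theorem eq_graphPlane_of_humbertEqs [Infinite k] {W : Submodule k (Pair k)}
    (hfin : Module.finrank k W = 3) (hW : ∀ p ∈ W, HumbertEqs p) : ∃ s, W = graphPlane k s := by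
  have horth : (polarForm k (Fin 3)).orthogonal W = W :=
    orthogonal_eq_self (by simpa using hfin) fun p hp => sub_eq_zero.mpr (hW p hp).1
  obtain ⟨σ, ε, hε, h⟩ := exists_signedPerm_of_orthogonal_eq_self horth fun p hp => (hW p hp).2
  obtain ⟨s, hs⟩ := exists_perm_of_signedPerm σ ε hε
  refine ⟨s, Submodule.eq_of_le_of_finrank_eq (fun p hp => ?_)
    (hfin.trans (finrank_graphPlane s).symm)⟩
  rw [mem_graphPlane, tet_mulVec_eq_signedPerm hs]
  exact funext (h p hp)

end Planes

/-! ### Linear maps permuting the planes -/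

section Grid

open Equiv

variable {α β ι : Type*}

theorem forall_fst_eq_or_forall_snd_eq {f : ι → α × β}
    (h : ∀ x y, (f x).1 = (f y).1 ∨ (f x).2 = (f y).2) :
    (∀ x y, (f x).1 = (f y).1) ∨ ∀ x y, (f x).2 = (f y).2 := by
  by_contra! hne
  obtain ⟨⟨x, y, hxy⟩, z, w, hzw⟩ := hne
  have hsnd (u : ι) : (f u).2 = (f x).2 := by
    by_cases hu : (f u).1 = (f x).1
    · exact ((h u y).resolve_left (hu ▸ hxy)).trans ((h x y).resolve_left hxy).symm
    · exact (h u x).resolve_left hu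
  exact hzw ((hsnd z).trans (hsnd w).symm)

theorem exists_perm_map_pair_iff {a b c d : α} :
    (∃ s : Perm α, s a = b ∧ s c = d) ↔ (a = c ↔ b = d) := by
  classical
  constructor
  · rintro ⟨s, rfl, rfl⟩
    exact s.injective.eq_iff.symm
  · intro h
    refine ⟨swap (swap a b c) d * swap a b, ?_, by simp⟩
    rcases eq_or_ne a c with rfl | hac
    · simp [h.mp rfl]
    · have hb : b ≠ swap a b c := fun hb => hac (by simpa using congrArg (swap a b) hb)
      simpa using swap_apply_of_ne_of_ne hb (mt h.mpr hac)

theorem exists_forall_ne_eq_of_card {S : Finset (Perm (Fin 4))} (hS : 6 ≤ S.card)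
    {h : Fin 4 → α} (hh : ∀ s ∈ S, ∀ a, h (s a) = h a) :
    ∃ a, ∀ b c, b ≠ a → c ≠ a → h b = h c := by
  have key : ∀ g : Fin 4 → Fin 4,
      6 ≤ (Finset.univ.filter fun s : Perm (Fin 4) => ∀ a, g (s a) = g a).card →
      ∃ a, ∀ b c, b ≠ a → c ≠ a → g b = g c := by decide +kernel
  have hinv (b : Fin 4) : h (Function.invFun h (h b)) = h b := Function.invFun_eq ⟨b, rfl⟩
  obtain ⟨a, ha⟩ := key (Function.invFun h ∘ h) (hS.trans (Finset.card_le_card fun s hs => by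
    simpa using fun a => congrArg (Function.invFun h) (hh s hs a)))
  exact ⟨a, fun b c hb hc => by simpa [hinv] using congrArg h (ha b c hb hc)⟩

theorem card_filter_perm_apply_eq :
    ∀ a b : Fin 4, (Finset.univ.filter fun s : Perm (Fin 4) => s a = b).card = 6 := by
  decide +kernel

variable [Finite α] {F : α × α → α × α}

theorem surjective_snd_of_fst_eq (hinj : F.Injective) {a : α}
    (h : ∀ b b', (F (a, b)).1 = (F (a, b')).1) : Function.Surjective fun b => (F (a, b)).2 :=
  Finite.surjective_of_injective fun b b' hb =>
    congrArg Prod.snd (hinj (Prod.ext (h b b') hb) : (a, b) = (a, b'))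

theorem exists_perm_prod_of_fst_eq (hinj : F.Injective)
    (hF : ∀ q r, q.1 = r.1 ∨ q.2 = r.2 → (F q).1 = (F r).1 ∨ (F q).2 = (F r).2)
    (hfst : ∀ a b b', (F (a, b)).1 = (F (a, b')).1) :
    ∃ s t : Perm α, ∀ a b, F (a, b) = (s a, t b) := by
  have hs : Function.Injective fun a => (F (a, a)).1 := fun a a' h => by
    obtain ⟨b, hb⟩ := surjective_snd_of_fst_eq hinj (hfst a) (F (a', a')).2
    exact congrArg Prod.fst (hinj (Prod.ext ((hfst a b a).trans h) hb) : (a, b) = (a', a'))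
  have hsnd (a a' b : α) : (F (a, b)).2 = (F (a', b)).2 := by
    by_cases ha : a = a'
    · rw [ha]
    · refine (hF (a, b) (a', b) (Or.inr rfl)).resolve_left fun h => ha (hs ?_)
      exact (hfst a a b).trans (h.trans (hfst a' b a'))
  have ht : Function.Injective fun b => (F (b, b)).2 := fun b b' h =>
    congrArg Prod.snd
      (hinj (Prod.ext (hfst b b b') (h.trans (hsnd b' b b'))) : (b, b) = (b, b'))
  exact ⟨.ofBijective _ (Finite.injective_iff_bijective.mp hs),
    .ofBijective _ (Finite.injective_iff_bijective.mp ht),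
    fun a b => Prod.ext (hfst a b a) (hsnd a b b)⟩

/-- Rows of the grid go to rows or to columns, and all of them to the same kind of line since a row
meets every column. -/
theorem exists_perm_prod_of_injective (hinj : F.Injective)
    (hF : ∀ q r, q.1 = r.1 ∨ q.2 = r.2 → (F q).1 = (F r).1 ∨ (F q).2 = (F r).2) :
    ∃ s t : Perm α, (∀ a b, F (a, b) = (s a, t b)) ∨ ∀ a b, F (a, b) = (t b, s a) := by
  have hrow (a : α) := forall_fst_eq_or_forall_snd_eq fun b b' =>
    hF (a, b) (a, b') (Or.inl rfl)
  by_cases hfst : ∀ a b b', (F (a, b)).1 = (F (a, b')).1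
  · obtain ⟨s, t, h⟩ := exists_perm_prod_of_fst_eq hinj hF hfst
    exact ⟨s, t, Or.inl h⟩
  obtain ⟨a₀, ha₀⟩ := not_forall.mp hfst
  have hsnd₀ := (hrow a₀).resolve_left ha₀
  have hswap : Function.Injective (Prod.swap ∘ F) := Prod.swap_injective.comp hinj
  have hsnd (a : α) : ∀ b b', (F (a, b)).2 = (F (a, b')).2 := by
    refine (hrow a).resolve_left fun hfsta => ha₀ ?_
    obtain ⟨b, hb⟩ := surjective_snd_of_fst_eq hinj hfsta (F (a₀, a₀)).2
    obtain ⟨b', hb'⟩ := surjective_snd_of_fst_eq hswap hsnd₀ (F (a, a)).1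
    have : (a, b) = (a₀, b') :=
      hinj (Prod.ext ((hfsta b a).trans hb'.symm) (hb.trans (hsnd₀ a₀ b')))
    obtain rfl : a = a₀ := congrArg Prod.fst this
    exact hfsta
  obtain ⟨s, t, h⟩ := exists_perm_prod_of_fst_eq hswap (fun q r hqr => (hF q r hqr).symm) hsnd
  exact ⟨s, t, Or.inr fun a b => Prod.swap_injective (h a b)⟩

end Grid

section Rigidity

open Equiv

variable {k : Type*} [Field k] [NeZero (2 : k)]

theorem exists_eq_smul_vertex {u : Fin 3 → k} {a : Fin 4}
    (h : ∀ b c, b ≠ a → c ≠ a → vertex k b ⬝ᵥ u = vertex k c ⬝ᵥ u) :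
    ∃ c : k, u = c • vertex k a := by
  obtain ⟨b, hb⟩ := exists_ne a
  refine ⟨(4 : k)⁻¹ * (vertex k a ⬝ᵥ u - vertex k b ⬝ᵥ u), ?_⟩
  have hsum : ∑ x, (vertex k x ⬝ᵥ u) • vertex k x =
      ∑ x, (vertex k x ⬝ᵥ u - vertex k b ⬝ᵥ u) • vertex k x := by
    simp only [sub_smul, Finset.sum_sub_distrib, ← Finset.smul_sum, sum_vertex, smul_zero,
      sub_zero]
  rw [mul_smul]
  nth_rewrite 1 [eq_sum_vertex (k := k) u]
  rw [hsum, Finset.sum_eq_single a]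
  · intro x _ hx
    rw [h x b hx hb, sub_self, zero_smul]
  · simp

/-- The products of pairs of elements of the tetrahedral representation. -/
def tetProd (k : Type*) [Field k] [NeZero (2 : k)] (s t : Perm (Fin 4)) : Pair k →ₗ[k] Pair k :=
  (tet k s).mulVecLin.prodMap (tet k t).mulVecLin

theorem tetProd_apply (s t : Perm (Fin 4)) (p : Pair k) :
    tetProd k s t p = ((tet k s).mulVec p.1, (tet k t).mulVec p.2) := rfl

theorem linearMap_ext_vertex_pair {M : Type*} [AddCommGroup M] [Module k M]
    {f g : Pair k →ₗ[k] M}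
    (h : ∀ a b, f (vertex k a, vertex k b) = g (vertex k a, vertex k b)) : f = g := by
  have hfst (a : Fin 4) : ((4 : k) • (vertex k a, 0) : Pair k) =
      ∑ b, (vertex k a, vertex k b) :=
    Prod.ext (funext fun j => by simp [Prod.fst_sum]) (by simp [Prod.snd_sum, sum_vertex])
  have hsnd (b : Fin 4) : ((4 : k) • (0, vertex k b) : Pair k) =
      ∑ a, (vertex k a, vertex k b) :=
    Prod.ext (by simp [Prod.fst_sum, sum_vertex]) (funext fun j => by simp [Prod.snd_sum])
  refine LinearMap.prod_ext (linearMap_ext_vertex fun a => ?_) (linearMap_ext_vertex fun b => ?_)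
  · refine smul_right_injective M (four_ne_zero_of_two (k := k)) ?_
    simp only [LinearMap.comp_apply, LinearMap.inl_apply, ← map_smul, hfst, map_sum, h]
  · refine smul_right_injective M (four_ne_zero_of_two (k := k)) ?_
    simp only [LinearMap.comp_apply, LinearMap.inr_apply, ← map_smul, hsnd, map_sum, h]

/-- Differences of the images of `(vₐ, v_b)` and `(vₐ, v_{b'})` do not depend on `a`, which forces
the proportionality factors to be equal. -/
theorem exists_eq_smul_tetProd {A : Pair k →ₗ[k] Pair k} {s t : Perm (Fin 4)}
    {c : Fin 4 → Fin 4 → k}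
    (h : ∀ a b, A (vertex k a, vertex k b) = c a b • (vertex k (s a), vertex k (t b))) :
    ∃ d : k, ∀ p, A p = d • tetProd k s t p := by
  have hdiff (a a' b b' : Fin 4) :
      A (vertex k a, vertex k b) - A (vertex k a, vertex k b') =
        A (vertex k a', vertex k b) - A (vertex k a', vertex k b') := by
    simp only [← map_sub, Prod.mk_sub_mk, sub_self]
  have hrow (a b b' : Fin 4) : c a b = c a b' := by
    obtain ⟨a', ha'⟩ := exists_ne a
    have := congrArg Prod.fst (hdiff a a' b b')
    simp only [h, Prod.fst_sub, Prod.smul_fst, ← sub_smul] at this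
    exact sub_eq_zero.mp (eq_zero_of_smul_vertex_eq_smul_vertex (s.injective.ne ha'.symm) this)
  have hcol (a a' b : Fin 4) : c a b = c a' b := by
    obtain ⟨b', hb'⟩ := exists_ne b
    have := congrArg Prod.snd (sub_eq_sub_iff_sub_eq_sub.mp (hdiff a a' b b'))
    simp only [h, Prod.snd_sub, Prod.smul_snd, ← sub_smul] at this
    exact sub_eq_zero.mp (eq_zero_of_smul_vertex_eq_smul_vertex (t.injective.ne hb'.symm) this)
  refine ⟨c 0 0, fun p => LinearMap.congr_fun
    (linearMap_ext_vertex_pair fun a b => ?_ : A = c 0 0 • tetProd k s t) p⟩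
  rw [h, hrow a b 0, hcol a 0 0, LinearMap.smul_apply, tetProd_apply, tet_mulVec_vertex,
    tet_mulVec_vertex]

theorem exists_eq_smul_vertex_pair {p : Pair k} {S : Finset (Perm (Fin 4))} (hS : 6 ≤ S.card)
    (h : ∀ s ∈ S, p ∈ graphPlane k s) :
    ∃ (c : k) (q : Fin 4 × Fin 4), p = c • (vertex k q.1, vertex k q.2) := by
  obtain ⟨s₀, hs₀⟩ := Finset.card_pos.mp (by lia : 0 < S.card)
  have hinv : ∀ s ∈ S, ∀ a,
      vertex k ((s₀⁻¹ * s) a) ⬝ᵥ p.1 = vertex k a ⬝ᵥ p.1 := by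
    intro s hs a
    rw [← vertex_dotProduct_tet_mulVec s₀, ← mem_graphPlane.mp (h s₀ hs₀),
      mem_graphPlane.mp (h s hs), ← Perm.mul_apply, mul_inv_cancel_left,
      vertex_dotProduct_tet_mulVec]
  obtain ⟨a, ha⟩ := exists_forall_ne_eq_of_card (h := fun a => vertex k a ⬝ᵥ p.1)
    (by rwa [Finset.card_image_of_injective _ (mul_right_injective s₀⁻¹)])
    (Finset.forall_mem_image.mpr hinv)
  obtain ⟨c, hc⟩ := exists_eq_smul_vertex ha
  refine ⟨c, (a, s₀ a), Prod.ext hc ?_⟩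
  rw [mem_graphPlane.mp (h s₀ hs₀), hc, Matrix.mulVec_smul, tet_mulVec_vertex, Prod.smul_snd]

variable {A : Pair k ≃ₗ[k] Pair k} {π : Perm (Fin 4) → Perm (Fin 4)}

theorem surjective_of_mem_graphPlane_iff
    (hA : ∀ s p, A p ∈ graphPlane k (π s) ↔ p ∈ graphPlane k s) : Function.Surjective π :=
  Finite.surjective_of_injective fun s t hst => graphPlane_injective (k := k)
    (Submodule.ext fun p => by rw [← hA s, ← hA t, hst])

theorem exists_grid_map (hA : ∀ s p, A p ∈ graphPlane k (π s) ↔ p ∈ graphPlane k s) :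
    ∃ (F : Fin 4 × Fin 4 → Fin 4 × Fin 4) (c : Fin 4 × Fin 4 → k), ∀ q, c q ≠ 0 ∧
      A (vertex k q.1, vertex k q.2) = c q • (vertex k (F q).1, vertex k (F q).2) := by
  have hcell (q : Fin 4 × Fin 4) : ∃ (r : Fin 4 × Fin 4) (c : k), c ≠ 0 ∧
      A (vertex k q.1, vertex k q.2) = c • (vertex k r.1, vertex k r.2) := by
    have hπ : Function.Injective π :=
      Finite.injective_iff_surjective.mpr (surjective_of_mem_graphPlane_iff hA)
    obtain ⟨c, r, hr⟩ := exists_eq_smul_vertex_pair (p := A (vertex k q.1, vertex k q.2))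
      (S := (Finset.univ.filter fun s : Perm (Fin 4) => s q.1 = q.2).image π)
      (by rw [Finset.card_image_of_injective _ hπ, card_filter_perm_apply_eq]) (by
        simp only [Finset.mem_image, Finset.mem_filter, Finset.mem_univ, true_and]
        rintro _ ⟨s, hs, rfl⟩
        exact (hA s _).mpr (vertex_pair_mem_graphPlane.mpr hs))
    refine ⟨r, c, fun hc => vertex_ne_zero (k := k) q.1 ?_, hr⟩
    rw [hc, zero_smul, LinearEquiv.map_eq_zero_iff] at hr
    exact congrArg Prod.fst hr
  choose F c h using hcell
  exact ⟨F, c, h⟩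

/-- A linear automorphism that permutes the planes permutes the lines spanned by the `(vₐ, v_b)`,
which are the lines on exactly six planes, and it preserves the relation of lying on a common
plane. -/
theorem exists_eq_smul_tetProd_of_mem_graphPlane_iff
    (hA : ∀ s p, A p ∈ graphPlane k (π s) ↔ p ∈ graphPlane k s) :
    ∃ (c : k) (s t : Perm (Fin 4)),
      (∀ p, A p = c • tetProd k s t p) ∨ ∀ p, A p = c • tetProd k s t p.swap := by
  obtain ⟨F, c, hF⟩ := exists_grid_map hA
  have hmem (s : Perm (Fin 4)) (q : Fin 4 × Fin 4) : π s (F q).1 = (F q).2 ↔ s q.1 = q.2 := by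
    rw [← vertex_pair_mem_graphPlane (k := k), ← vertex_pair_mem_graphPlane (k := k), ← hA s,
      (hF q).2, Submodule.smul_mem_iff _ (hF q).1]
  have hplane (q r : Fin 4 × Fin 4) :
      ((F q).1 = (F r).1 ↔ (F q).2 = (F r).2) ↔ (q.1 = r.1 ↔ q.2 = r.2) := by
    rw [← exists_perm_map_pair_iff, ← exists_perm_map_pair_iff,
      (surjective_of_mem_graphPlane_iff hA).exists]
    simp only [hmem]
  have hinj : F.Injective := by
    intro q r hqr
    have h : A (c r • (vertex k q.1, vertex k q.2)) = A (c q • (vertex k r.1, vertex k r.2)) := by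
      rw [map_smul, map_smul, (hF q).2, (hF r).2, hqr, smul_comm]
    have h := A.injective h
    refine Prod.ext ?_ ?_ <;> by_contra hne
    · exact (hF r).1 (eq_zero_of_smul_vertex_eq_smul_vertex hne (congrArg Prod.fst h))
    · exact (hF r).1 (eq_zero_of_smul_vertex_eq_smul_vertex hne (congrArg Prod.snd h))
  have hcol (q r : Fin 4 × Fin 4) (hqr : q.1 = r.1 ∨ q.2 = r.2) :
      (F q).1 = (F r).1 ∨ (F q).2 = (F r).2 := by
    have := hplane q r
    have : q = r → F q = F r := congrArg F
    grind
  obtain ⟨s, t, h | h⟩ := exists_perm_prod_of_injective hinj hcol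
  · obtain ⟨d, hd⟩ := exists_eq_smul_tetProd (A := A.toLinearMap) (c := fun a b => c (a, b))
      fun a b => (hF (a, b)).2.trans (by rw [h])
    exact ⟨d, s, t, Or.inl hd⟩
  · obtain ⟨d, hd⟩ := exists_eq_smul_tetProd (c := fun a b => c (b, a))
      (A := A.toLinearMap ∘ₗ (LinearEquiv.prodComm k _ _).toLinearMap)
      fun a b => (hF (b, a)).2.trans (by rw [h])
    exact ⟨d, t, s, Or.inr fun p => hd p.swap⟩

end Rigidity

/-! ### The action of the projective linear group -/

section GeneralLinearGroup

variable {n R : Type*} [Fintype n] [DecidableEq n] [CommRing R]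

theorem smul_eq_mulVec (g : GL n R) (v : n → R) : g • v = g.val.mulVec v := rfl

theorem scalar_smul (u : Rˣ) (v : n → R) :
    Matrix.GeneralLinearGroup.scalar n u • v = (u : R) • v := by
  simp [smul_eq_mulVec, Matrix.scalar_apply, ← Matrix.smul_one_eq_diagonal, Matrix.smul_mulVec]

theorem generalLinearGroup_ext {g h : GL n R} (H : ∀ v : n → R, g • v = h • v) : g = h :=
  Units.ext (Matrix.ext_of_mulVec_single fun j => H (Pi.single j 1))

theorem mk_eq_mk_iff_exists_smul {g h : GL n R} :
    Matrix.ProjGenLinGroup.mk g = Matrix.ProjGenLinGroup.mk h ↔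
      ∃ u : Rˣ, ∀ v : n → R, g • v = (u : R) • h • v := by
  rw [eq_comm, Matrix.ProjGenLinGroup.mk_eq_mk_iff]
  refine exists_congr fun u => ⟨?_, fun H => generalLinearGroup_ext fun v => ?_⟩
  · rintro rfl v
    rw [mul_smul, scalar_smul, smul_comm]
  · rw [mul_smul, scalar_smul, smul_comm, H]

theorem setOf_submodule_le_injective {ι k : Type*} [Field k] {W W' : Submodule k (ι → k)}
    (h : {P : ℙ k (ι → k) | P.submodule ≤ W} = {P | P.submodule ≤ W'}) : W = W' := by
  ext v
  by_cases hv : v = 0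
  · simp [hv]
  have := Set.ext_iff.mp h (Projectivization.mk k v hv)
  simpa [Projectivization.submodule_mk, Submodule.span_singleton_le_iff_mem] using this

end GeneralLinearGroup

section Action

open Equiv

variable {k : Type*} [Field k] {i : k} (hi : i ^ 2 = -1)

/-- The point of `ℙ⁵` with coordinates `(x, z)`. -/
def point (p : Pair k) (hp : p ≠ 0) : ℙ k (KIdx → k) :=
  Projectivization.mk k (kleinEquiv hi p) ((kleinEquiv hi).map_ne_zero_iff.mpr hp)

theorem exists_eq_point (P : ℙ k (KIdx → k)) : ∃ p hp, P = point hi p hp := by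
  induction P using Projectivization.ind with
  | h v hv =>
    refine ⟨(kleinEquiv hi).symm v, (kleinEquiv hi).symm.map_ne_zero_iff.mpr hv, ?_⟩
    simp [point]

theorem point_eq_point_iff {p q : Pair k} {hp : p ≠ 0} {hq : q ≠ 0} :
    point hi p hp = point hi q hq ↔ ∃ c : k, c • q = p := by
  rw [point, point, Projectivization.mk_eq_mk_iff']
  simp only [← map_smul, (kleinEquiv hi).injective.eq_iff]

theorem point_submodule {p : Pair k} (hp : p ≠ 0) :
    (point hi p hp).submodule = Submodule.span k {kleinEquiv hi p} :=
  Projectivization.submodule_mk _ _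

/-- The linear transformation of the coordinates `(x, z)` given by a matrix acting on the Klein
coordinates. -/
def pairMap : GL KIdx k →* (Pair k ≃ₗ[k] Pair k) where
  toFun g := (kleinEquiv hi).trans
    ((DistribMulAction.toLinearEquiv k (KIdx → k) g).trans (kleinEquiv hi).symm)
  map_one' := by ext p <;> simp
  map_mul' g h := by ext p <;> simp [mul_smul]

theorem kleinEquiv_pairMap (g : GL KIdx k) (p : Pair k) :
    kleinEquiv hi (pairMap hi g p) = g • kleinEquiv hi p := by
  simp [pairMap]

theorem mk_smul_point (g : GL KIdx k) {p : Pair k} (hp : p ≠ 0) :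
    Matrix.ProjGenLinGroup.mk g • point hi p hp =
      point hi (pairMap hi g p) ((pairMap hi g).map_ne_zero_iff.mpr hp) := by
  rw [point, Projectivization.PGL.mk_smul_mk, point]
  congr 1
  exact (kleinEquiv_pairMap hi g p).symm

theorem mk_eq_mk_iff_pairMap {g h : GL KIdx k} :
    Matrix.ProjGenLinGroup.mk g = Matrix.ProjGenLinGroup.mk h ↔
      ∃ c : k, ∀ p, pairMap hi g p = c • pairMap hi h p := by
  have key (c : k) : (∀ p, pairMap hi g p = c • pairMap hi h p) ↔
      ∀ v : KIdx → k, g • v = c • h • v := by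
    rw [(kleinEquiv hi).surjective.forall]
    simp only [← kleinEquiv_pairMap, ← map_smul, (kleinEquiv hi).injective.eq_iff]
  rw [mk_eq_mk_iff_exists_smul]
  constructor
  · rintro ⟨u, hu⟩
    exact ⟨u, (key u).mpr hu⟩
  · rintro ⟨c, hc⟩
    have hc0 : c ≠ 0 := by
      rintro rfl
      obtain ⟨p, hp⟩ := exists_ne (0 : Pair k)
      exact hp ((pairMap hi g).map_eq_zero_iff.mp (by rw [hc, zero_smul]))
    exact ⟨Units.mk0 c hc0, (key c).mp hc⟩

theorem pairMap_g₀ (p : Pair k) : pairMap hi (g₀ k) p = i • p.swap := by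
  apply (kleinEquiv hi).injective
  rw [kleinEquiv_pairMap, kleinEquiv_apply, g₀_smul, kleinEquiv_apply]
  ext (j | j)
  · simp
  · simp only [Sum.elim_inr, Prod.smul_snd, Prod.snd_swap, Pi.smul_apply, smul_eq_mul]
    linear_combination p.1 j * hi

variable [NeZero (2 : k)]

/-- The block diagonal matrices formed from pairs of elements of the tetrahedral representation. -/
def tetBlock (k : Type*) [Field k] [NeZero (2 : k)] :
    Perm (Fin 4) × Perm (Fin 4) →* GL KIdx k :=
  MonoidHom.toHomUnits
    { toFun := fun n => Matrix.fromBlocks (tet k n.1) 0 0 (tet k n.2)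
      map_one' := by simp
      map_mul' := fun n m => by simp [Matrix.fromBlocks_multiply] }

theorem tetBlock_smul (n : Perm (Fin 4) × Perm (Fin 4)) (x y : Fin 3 → k) :
    tetBlock k n • (Sum.elim x y : KIdx → k) =
      Sum.elim ((tet k n.1).mulVec x) ((tet k n.2).mulVec y) := by
  change (Matrix.fromBlocks (tet k n.1) 0 0 (tet k n.2)).mulVec _ = _
  simp [Matrix.fromBlocks_mulVec]

theorem pairMap_tetBlock (n : Perm (Fin 4) × Perm (Fin 4)) (p : Pair k) :
    pairMap hi (tetBlock k n) p = tetProd k n.1 n.2 p := by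
  apply (kleinEquiv hi).injective
  rw [kleinEquiv_pairMap, kleinEquiv_apply, tetBlock_smul, kleinEquiv_apply, tetProd_apply,
    Matrix.mulVec_smul]

theorem range_mk_tetBlock :
    Set.range (fun n => Matrix.ProjGenLinGroup.mk (tetBlock k n)) = obviousSymmetries k := by
  ext γ
  constructor
  · rintro ⟨⟨s, t⟩, rfl⟩
    obtain ⟨σ, ε, hε, hs⟩ := exists_signedPerm_of_perm s
    obtain ⟨τ, e, he, ht⟩ := exists_signedPerm_of_perm t
    refine ⟨tetBlock k (s, t), σ, τ, ε, e, hε, he, fun x y => ?_, rfl⟩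
    rw [tetBlock_smul, tet_mulVec_eq_signedPerm hs, tet_mulVec_eq_signedPerm ht]
  · rintro ⟨g, σ, τ, ε, e, hε, he, hg, rfl⟩
    obtain ⟨s, hs⟩ := exists_perm_of_signedPerm σ ε hε
    obtain ⟨t, ht⟩ := exists_perm_of_signedPerm τ e he
    refine ⟨(s, t), congrArg _ (generalLinearGroup_ext fun v => ?_)⟩
    rw [← Sum.elim_comp_inl_inr v, hg, tetBlock_smul, tet_mulVec_eq_signedPerm hs,
      tet_mulVec_eq_signedPerm ht]

theorem point_mem_humbertComplex_iff {p : Pair k} (hp : p ≠ 0) :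
    point hi p hp ∈ humbertComplex i ↔ HumbertEqs p :=
  mk_mem_humbertComplex_iff hi p _

theorem mk_mem_projectiveAut_iff {g : GL KIdx k} :
    Matrix.ProjGenLinGroup.mk g ∈ projectiveAut (humbertComplex i) ↔
      ∀ p, HumbertEqs (pairMap hi g p) ↔ HumbertEqs p := by
  rw [MulAction.mem_stabilizer_set]
  constructor
  · intro h p
    by_cases hp : p = 0
    · simp [hp]
    have := h (point hi p hp)
    rwa [mk_smul_point, point_mem_humbertComplex_iff, point_mem_humbertComplex_iff] at this
  · intro h P
    obtain ⟨p, hp, rfl⟩ := exists_eq_point hi P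
    rw [mk_smul_point, point_mem_humbertComplex_iff, point_mem_humbertComplex_iff, h]

/-- The set of points of the plane given by `graphPlane k s`. -/
def planeSet (s : Perm (Fin 4)) : Set (ℙ k (KIdx → k)) :=
  {P | P.submodule ≤ (graphPlane k s).map (kleinEquiv hi).toLinearMap}

theorem point_mem_planeSet_iff {p : Pair k} (hp : p ≠ 0) {s : Perm (Fin 4)} :
    point hi p hp ∈ planeSet hi s ↔ p ∈ graphPlane k s := by
  rw [planeSet, Set.mem_ofPred_eq, point_submodule, Submodule.span_singleton_le_iff_mem]
  exact (Submodule.mem_map_equiv _).trans (by rw [LinearEquiv.symm_apply_apply])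

theorem planeSet_injective : Function.Injective (planeSet (k := k) hi) := fun _ _ h =>
  graphPlane_injective (k := k)
    (Submodule.map_injective_of_injective (kleinEquiv hi).injective
      (setOf_submodule_le_injective h))

theorem planesIn_humbertComplex [Infinite k] :
    planesIn (humbertComplex i) = Set.range (planeSet hi) := by
  ext E
  constructor
  · rintro ⟨hE, W, hW, rfl⟩
    have hWE : ∀ p ∈ W.map (kleinEquiv hi).symm.toLinearMap, HumbertEqs p := by
      intro p hp
      by_cases hp0 : p = 0
      · simp [hp0, HumbertEqs]
      refine (point_mem_humbertComplex_iff hi hp0).mp (hE ?_)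
      rw [Set.mem_ofPred_eq, point_submodule, Submodule.span_singleton_le_iff_mem]
      exact (Submodule.mem_map_equiv _).mp hp
    obtain ⟨s, hs⟩ := eq_graphPlane_of_humbertEqs (by rw [LinearEquiv.finrank_map_eq, hW]) hWE
    refine ⟨s, ?_⟩
    rw [planeSet, ← hs, ← Submodule.map_comp]
    simp
  · rintro ⟨s, rfl⟩
    refine ⟨fun P hP => ?_, _, ?_, rfl⟩
    · obtain ⟨p, hp, rfl⟩ := exists_eq_point hi P
      rw [point_mem_planeSet_iff] at hP
      exact (point_mem_humbertComplex_iff hi hp).mpr (humbertEqs_of_mem_graphPlane hP)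
    · rw [LinearEquiv.finrank_map_eq, finrank_graphPlane]

theorem exists_pairMap_mem_graphPlane_iff [Infinite k] {g : GL KIdx k}
    (hg : Matrix.ProjGenLinGroup.mk g ∈ projectiveAut (humbertComplex i)) (s : Perm (Fin 4)) :
    ∃ t, ∀ p, pairMap hi g p ∈ graphPlane k t ↔ p ∈ graphPlane k s := by
  rw [mk_mem_projectiveAut_iff hi] at hg
  obtain ⟨t, ht⟩ := eq_graphPlane_of_humbertEqs
    (W := (graphPlane k s).map (pairMap hi g).toLinearMap)
    (by rw [LinearEquiv.finrank_map_eq, finrank_graphPlane])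
    (by
      rintro _ ⟨p, hp, rfl⟩
      exact (hg p).mpr (humbertEqs_of_mem_graphPlane hp))
  refine ⟨t, fun p => ?_⟩
  rw [← ht]
  exact (Submodule.mem_map_equiv _).trans (by rw [LinearEquiv.symm_apply_apply])

theorem exists_pairMap_eq [Infinite k] {g : GL KIdx k}
    (hg : Matrix.ProjGenLinGroup.mk g ∈ projectiveAut (humbertComplex i)) :
    ∃ (c : k) (s t : Perm (Fin 4)), (∀ p, pairMap hi g p = c • tetProd k s t p) ∨
      ∀ p, pairMap hi g p = c • tetProd k s t p.swap := by
  choose π hπ using exists_pairMap_mem_graphPlane_iff hi hg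
  exact exists_eq_smul_tetProd_of_mem_graphPlane_iff hπ

theorem mk_smul_planeSet {g : GL KIdx k} {s t : Perm (Fin 4)}
    (h : ∀ p, pairMap hi g p ∈ graphPlane k t ↔ p ∈ graphPlane k s) :
    Matrix.ProjGenLinGroup.mk g • planeSet hi s = planeSet hi t := by
  ext P
  obtain ⟨P, rfl⟩ := MulAction.surjective (Matrix.ProjGenLinGroup.mk g) P
  obtain ⟨p, hp, rfl⟩ := exists_eq_point hi P
  dsimp only
  rw [Set.smul_mem_smul_set_iff, mk_smul_point, point_mem_planeSet_iff, point_mem_planeSet_iff, h]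

end Action

/-! ### Tangent spaces -/

section Tangent

theorem derivation_aeval {R A M ι : Type*} [CommSemiring R] [CommSemiring A] [Algebra R A]
    [AddCommMonoid M] [Module A M] [Module R M] [Fintype ι] (D : Derivation R A M) (g : ι → A)
    (f : MvPolynomial ι R) :
    D (MvPolynomial.aeval g f) =
      ∑ j, MvPolynomial.aeval g (MvPolynomial.pderiv j f) • D (g j) := by
  classical
  induction f using MvPolynomial.induction_on with
  | C a => simp
  | add p q hp hq => simp only [map_add, hp, hq, add_smul, Finset.sum_add_distrib]
  | mul_X p n hp =>
    simp [hp, Derivation.leibniz, MvPolynomial.pderiv_X, Finset.sum_add_distrib, add_smul,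
      Finset.smul_sum, mul_smul, Pi.single_apply, apply_ite]

variable {k ι : Type*} [Field k]

/-- The coordinates of the parametrized line `t ↦ v + t w`. -/
noncomputable def lineParam (v w : ι → k) (j : ι) : Polynomial k :=
  Polynomial.C (v j) + Polynomial.C (w j) * Polynomial.X

theorem eval_aeval_lineParam (v w : ι → k) (t : k) (f : MvPolynomial ι k) :
    Polynomial.eval t (MvPolynomial.aeval (lineParam v w) f) =
      MvPolynomial.eval (v + t • w) f := by
  rw [← Polynomial.coe_evalRingHom, MvPolynomial.aeval_def, MvPolynomial.hom_eval₂,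
    MvPolynomial.eval, MvPolynomial.coe_eval₂Hom]
  congr 1
  · ext; simp
  · ext; simp [lineParam, mul_comm t]

theorem eval_derivative_aeval_lineParam [Fintype ι] (v w : ι → k) (f : MvPolynomial ι k) :
    Polynomial.eval 0 (Polynomial.derivative (MvPolynomial.aeval (lineParam v w) f)) =
      ∑ j, MvPolynomial.eval v (MvPolynomial.pderiv j f) * w j := by
  have h := derivation_aeval (R := k) (Polynomial.derivative' (R := k)) (lineParam v w) f
  simp only [Polynomial.derivative'_apply] at h
  rw [h, Polynomial.eval_finsetSum]
  simp [eval_aeval_lineParam, lineParam]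

theorem aeval_lineParam_eq_zero [Infinite k] {X : Set (ℙ k (ι → k))} {f : MvPolynomial ι k}
    (hf : VanishesOn f X) {W : Submodule k (ι → k)}
    (hW : {Q : ℙ k (ι → k) | Q.submodule ≤ W} ⊆ X) {v w : ι → k} (hv : v ∈ W) (hv0 : v ≠ 0)
    (hw : w ∈ W) : MvPolynomial.aeval (lineParam v w) f = 0 := by
  have hfin : {t : k | v + t • w = 0}.Finite := by
    refine Set.Subsingleton.finite fun t ht t' ht' => ?_
    have h : (t - t') • w = 0 := by
      rw [sub_smul, sub_eq_zero]
      exact add_left_cancel (Eq.trans ht (Eq.symm ht'))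
    refine (smul_eq_zero.mp h).elim sub_eq_zero.mp fun hw0 => absurd ht ?_
    simpa [hw0] using hv0
  refine Polynomial.eq_zero_of_infinite_isRoot _
    (hfin.infinite_compl.mono fun t (ht : v + t • w ≠ 0) => ?_)
  change Polynomial.eval t _ = 0
  rw [eval_aeval_lineParam]
  refine hf _ ht (hW ?_)
  rw [Set.mem_ofPred_eq, Projectivization.submodule_mk, Submodule.span_singleton_le_iff_mem]
  exact W.add_mem hv (W.smul_mem t hw)

theorem le_coneTangentSpace [Fintype ι] [Infinite k] {X : Set (ℙ k (ι → k))} {P : ℙ k (ι → k)}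
    {W : Submodule k (ι → k)} (hW : {Q : ℙ k (ι → k) | Q.submodule ≤ W} ⊆ X)
    (hP : P.submodule ≤ W) : W ≤ coneTangentSpace X P := by
  intro w hw d f _ hf
  have hrep : P.rep ∈ W :=
    hP (P.submodule_eq ▸ Submodule.mem_span_singleton_self _)
  rw [← eval_derivative_aeval_lineParam, aeval_lineParam_eq_zero hf hW hrep P.rep_nonzero hw]
  simp

end Tangent

section TangentHumbert

open Equiv MvPolynomial

variable {k : Type*} [Field k]

theorem finrank_coneTangentSpace {i : k} (hi : i ^ 2 = -1) (P : ℙ k (KIdx → k)) :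
    Module.finrank k (coneTangentSpace (humbertComplex i) P) = Module.finrank k
      ((coneTangentSpace (humbertComplex i) P).comap (kleinEquiv hi).toLinearMap) := by
  rw [Submodule.comap_equiv_eq_map_symm, LinearEquiv.finrank_map_eq]

/-- The Klein quadric in Klein coordinates. -/
noncomputable def quadricForm (k : Type*) [Field k] : MvPolynomial KIdx k := ∑ j, X j ^ 2

/-- The cubic that cuts out the Humbert complex on the Klein quadric. -/
noncomputable def cubicForm (i : k) : MvPolynomial KIdx k :=
  ∏ j, X (Sum.inl j) + C i * ∏ j, X (Sum.inr j)

theorem isHomogeneous_quadricForm : (quadricForm k).IsHomogeneous 2 :=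
  IsHomogeneous.sum _ _ _ fun j _ => isHomogeneous_X_pow j 2

theorem isHomogeneous_cubicForm (i : k) : (cubicForm i).IsHomogeneous 3 := by
  have h (f : Fin 3 → KIdx) : (∏ j, X (f j) : MvPolynomial KIdx k).IsHomogeneous 3 :=
    IsHomogeneous.prod _ _ (fun _ => 1) fun j _ => isHomogeneous_X k (f j)
  simpa [cubicForm] using (h Sum.inl).add ((isHomogeneous_C KIdx i).mul (h Sum.inr))

variable {i : k} (hi : i ^ 2 = -1)

theorem eval_quadricForm (p : Pair k) :
    eval (kleinEquiv hi p) (quadricForm k) = p.1 ⬝ᵥ p.1 - p.2 ⬝ᵥ p.2 := by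
  simp [quadricForm, kleinEquiv_apply, mul_pow, hi, dotProduct, ← sq, sub_eq_add_neg]

theorem eval_cubicForm (p : Pair k) :
    eval (kleinEquiv hi p) (cubicForm i) = ∏ j, p.1 j - ∏ j, p.2 j := by
  simp only [cubicForm, kleinEquiv_apply, map_add, map_mul, eval_X, eval_C,
    Sum.elim_inl, Sum.elim_inr, Pi.smul_apply, smul_eq_mul, Fin.prod_univ_three]
  linear_combination p.2 0 * p.2 1 * p.2 2 * (1 - i ^ 2) * hi

include hi in
theorem vanishesOn_quadricForm_and_cubicForm [NeZero (2 : k)] :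
    VanishesOn (quadricForm k) (humbertComplex i) ∧
      VanishesOn (cubicForm i) (humbertComplex i) := by
  have key (v : KIdx → k) (hv : v ≠ 0) (h : Projectivization.mk k v hv ∈ humbertComplex i) :
      ∃ p, v = kleinEquiv hi p ∧ HumbertEqs p := by
    obtain ⟨p, rfl⟩ := (kleinEquiv hi).surjective v
    exact ⟨p, rfl, (mk_mem_humbertComplex_iff hi p hv).mp h⟩
  constructor <;> intro v hv h <;> obtain ⟨p, rfl, hp⟩ := key v hv h
  · rw [eval_quadricForm, hp.1, sub_self]
  · rw [eval_cubicForm, hp.2, sub_self]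

/-- The gradient of `x₀ x₁ x₂`. -/
def cofactors (x : Fin 3 → k) : Fin 3 → k := ![x 1 * x 2, x 0 * x 2, x 0 * x 1]

theorem pderiv_quadricForm (j : KIdx) : pderiv j (quadricForm k) = C 2 * X j := by
  rw [quadricForm, map_sum, Finset.sum_eq_single_of_mem j (Finset.mem_univ j)]
  · simp [pderiv_X, ← map_ofNat C 2]
  · intro l _ hl
    simp [pderiv_X, hl]

theorem sum_eval_pderiv_quadricForm (p q : Pair k) :
    ∑ j, eval (kleinEquiv hi p) (pderiv j (quadricForm k)) * kleinEquiv hi q j =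
      2 * polarForm k (Fin 3) p q := by
  simp only [pderiv_quadricForm, map_mul, eval_X, eval_C, kleinEquiv_apply, Fintype.sum_sum_type,
    Fin.sum_univ_three, Sum.elim_inl, Sum.elim_inr, Pi.smul_apply, smul_eq_mul, polarForm_apply,
    dotProduct]
  linear_combination 2 * (p.2 0 * q.2 0 + p.2 1 * q.2 1 + p.2 2 * q.2 2) * hi

theorem sum_eval_pderiv_cubicForm (p q : Pair k) :
    ∑ j, eval (kleinEquiv hi p) (pderiv j (cubicForm i)) * kleinEquiv hi q j =
      polarForm k (Fin 3) (cofactors p.1, cofactors p.2) q := by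
  rw [polarForm_apply, Matrix.vec3_dotProduct, Matrix.vec3_dotProduct]
  simp only [kleinEquiv_apply, cubicForm, cofactors, Fin.prod_univ_three, Fin.sum_univ_three,
    Fintype.sum_sum_type, map_add, map_mul, map_zero, Derivation.leibniz, derivation_C, pderiv_X,
    Pi.single_apply, Pi.smul_apply, smul_eq_mul, eval_X, eval_C, Sum.elim_inl, Sum.elim_inr,
    Sum.inl.injEq, Sum.inr.injEq, reduceCtorEq, Fin.reduceEq, zero_ne_one, one_ne_zero, if_true,
    if_false, mul_ite, mul_one, mul_zero, add_zero, zero_add, Matrix.cons_val_zero,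
    Matrix.cons_val_one, Matrix.cons_val]
  linear_combination (p.2 1 * p.2 2 * q.2 0 + p.2 0 * p.2 2 * q.2 1 + p.2 0 * p.2 1 * q.2 2) *
    (1 - i ^ 2) * hi

theorem exists_eq_smul_of_polarForm_eq_zero {ι : Type*} [Fintype ι]
    {T : Submodule k ((ι → k) × (ι → k))} {p q : (ι → k) × (ι → k)} (hp : p ≠ 0)
    (hT : 2 * Fintype.card ι ≤ Module.finrank k T + 1)
    (h : ∀ r ∈ T, polarForm k ι p r = 0 ∧ polarForm k ι q r = 0) : ∃ c : k, q = c • p := by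
  have hdim := LinearMap.BilinForm.finrank_orthogonal (W := T)
    (polarForm_nondegenerate (k := k) (ι := ι))
  rw [Module.finrank_prod, Module.finrank_fintype_fun_eq_card] at hdim
  have hspan : Submodule.span k {p} = (polarForm k ι).orthogonal T := by
    refine Submodule.eq_of_le_of_finrank_le ?_ (by rw [finrank_span_singleton hp]; lia)
    rw [Submodule.span_singleton_le_iff_mem]
    exact fun r hr => (polarForm_comm r p).trans (h r hr).1
  have hq : q ∈ Submodule.span k {p} := hspan ▸ fun r hr => (polarForm_comm r q).trans (h r hr).2
  obtain ⟨c, hc⟩ := Submodule.mem_span_singleton.mp hq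
  exact ⟨c, hc.symm⟩

variable [NeZero (2 : k)]

theorem polarForm_eq_zero_of_mem_coneTangentSpace {P : ℙ k (KIdx → k)} {p q : Pair k}
    (hp : P.rep = kleinEquiv hi p)
    (hq : kleinEquiv hi q ∈ coneTangentSpace (humbertComplex i) P) :
    polarForm k (Fin 3) p q = 0 ∧ polarForm k (Fin 3) (cofactors p.1, cofactors p.2) q = 0 := by
  obtain ⟨hquad, hcub⟩ := vanishesOn_quadricForm_and_cubicForm hi
  have h2 := hq 2 _ isHomogeneous_quadricForm hquad
  have h3 := hq 3 _ (isHomogeneous_cubicForm i) hcub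
  rw [hp, sum_eval_pderiv_quadricForm] at h2
  rw [hp, sum_eval_pderiv_cubicForm] at h3
  exact ⟨(mul_eq_zero.mp h2).resolve_left two_ne_zero, h3⟩

theorem exists_cofactors_eq_smul {P : ℙ k (KIdx → k)}
    (hP : P ∈ singularPoints 3 (humbertComplex i)) :
    ∃ (p : Pair k) (hp : p ≠ 0) (c : k), P = point hi p hp ∧ HumbertEqs p ∧
      cofactors p.1 = c • p.1 ∧ cofactors p.2 = c • p.2 := by
  obtain ⟨hPX, hdim⟩ := hP
  rw [finrank_coneTangentSpace hi] at hdim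
  have hp : (kleinEquiv hi).symm P.rep ≠ 0 :=
    (kleinEquiv hi).symm.map_ne_zero_iff.mpr P.rep_nonzero
  have hPp : P = point hi _ hp := by simp [point]
  obtain ⟨c, hc⟩ := exists_eq_smul_of_polarForm_eq_zero hp (Nat.succ_le_succ hdim) fun q hq =>
    polarForm_eq_zero_of_mem_coneTangentSpace hi ((kleinEquiv hi).apply_symm_apply _).symm hq
  rw [hPp] at hPX
  exact ⟨_, hp, c, hPp, (point_mem_humbertComplex_iff hi hp).mp hPX, congrArg Prod.fst hc,
    congrArg Prod.snd hc⟩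

theorem graphPlane_le_comap_coneTangentSpace [Infinite k] {p : Pair k} (hp : p ≠ 0)
    {s : Perm (Fin 4)} (h : p ∈ graphPlane k s) : graphPlane k s ≤
      (coneTangentSpace (humbertComplex i) (point hi p hp)).comap (kleinEquiv hi).toLinearMap := by
  rw [← Submodule.map_le_iff_le_comap]
  refine le_coneTangentSpace ?_ ((point_mem_planeSet_iff hi hp).mpr h)
  exact (planesIn_humbertComplex hi ▸ Set.mem_range_self s :
    planeSet hi s ∈ planesIn (humbertComplex i)).1

omit hi in
theorem linearIndependent_vertex_sub {a b c d : Fin 4} (hab : a ≠ b) (hac : a ≠ c) (had : a ≠ d)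
    (hcd : c ≠ d) : LinearIndependent k ![vertex k b - vertex k a, vertex k d - vertex k c] := by
  refine LinearIndependent.pair_iff.mpr fun r t h => ?_
  have h4 : (4 : k) ≠ 0 := four_ne_zero_of_two
  have ha := congrArg (vertex k a ⬝ᵥ ·) h
  have hc := congrArg (vertex k c ⬝ᵥ ·) h
  simp only [dotProduct_add, dotProduct_smul, dotProduct_sub, vertex_dotProduct, if_neg hab,
    if_neg hac, if_neg had, if_neg hcd, if_neg hac.symm, if_true, dotProduct_zero,
    smul_eq_mul] at ha hc
  have hr : r = 0 := (mul_eq_zero.mp (by linear_combination -ha : r * 4 = 0)).resolve_right h4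
  rw [hr] at hc
  exact ⟨hr, (mul_eq_zero.mp (by linear_combination -hc : t * 4 = 0)).resolve_right h4⟩

theorem five_le_finrank_of_graphPlane_le {T : Submodule k (Pair k)} {s : Perm (Fin 4)}
    {a b c d : Fin 4} (hab : a ≠ b) (hac : a ≠ c) (had : a ≠ d) (hcd : c ≠ d)
    (hs : graphPlane k s ≤ T) (hsab : graphPlane k (s * swap a b) ≤ T)
    (hscd : graphPlane k (s * swap c d) ≤ T) : 5 ≤ Module.finrank k T := by
  have sub_mem {x y : Fin 4} (h : graphPlane k (s * swap x y) ≤ T) :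
      (0, vertex k (s y) - vertex k (s x)) ∈ T := by
    have hy : (vertex k x, vertex k (s y)) ∈ T := h (vertex_pair_mem_graphPlane.mpr (by simp))
    have hx : (vertex k x, vertex k (s x)) ∈ T := hs (vertex_pair_mem_graphPlane.mpr rfl)
    simpa using T.sub_mem hy hx
  let N : Submodule k (Fin 3 → k) := Submodule.span k
    (Set.range ![vertex k (s b) - vertex k (s a), vertex k (s d) - vertex k (s c)])
  have hN : Module.finrank k N = 2 := finrank_span_eq_card (linearIndependent_vertex_sub
    (s.injective.ne hab) (s.injective.ne hac) (s.injective.ne had) (s.injective.ne hcd))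
  have hNT : N.map (LinearMap.inr k _ _) ≤ T := by
    rw [Submodule.map_le_iff_le_comap, Submodule.span_le, Set.range_subset_iff, Fin.forall_fin_two]
    exact ⟨sub_mem hsab, sub_mem hscd⟩
  have hinf : graphPlane k s ⊓ N.map (LinearMap.inr k _ _) = ⊥ := by
    rw [eq_bot_iff]
    rintro _ ⟨hgraph, z, -, rfl⟩
    simpa [mem_graphPlane] using hgraph
  have hdim := Submodule.finrank_sup_add_finrank_inf_eq (graphPlane k s)
    (N.map (LinearMap.inr k (Fin 3 → k) (Fin 3 → k)))
  rw [hinf, finrank_bot, finrank_graphPlane,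
    ← (Submodule.equivMapOfInjective _ LinearMap.inr_injective N).finrank_eq, hN] at hdim
  exact hdim.symm.le.trans (Submodule.finrank_mono (sup_le hs hNT))

theorem point_mem_singularPoints [Infinite k] {p : Pair k} (hp : p ≠ 0) {s : Perm (Fin 4)}
    {a b c d : Fin 4} (hab : a ≠ b) (hac : a ≠ c) (had : a ≠ d) (hcd : c ≠ d)
    (hs : p ∈ graphPlane k s) (hsab : p ∈ graphPlane k (s * swap a b))
    (hscd : p ∈ graphPlane k (s * swap c d)) :
    point hi p hp ∈ singularPoints 3 (humbertComplex i) := by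
  refine ⟨(point_mem_humbertComplex_iff hi hp).mpr (humbertEqs_of_mem_graphPlane hs), ?_⟩
  rw [finrank_coneTangentSpace hi]
  exact five_le_finrank_of_graphPlane_le hab hac had hcd
    (graphPlane_le_comap_coneTangentSpace hi hp hs)
    (graphPlane_le_comap_coneTangentSpace hi hp hsab)
    (graphPlane_le_comap_coneTangentSpace hi hp hscd)

end TangentHumbert

/-! ### The singular points -/

section SingularPoints

open Equiv

theorem exists_vertexSign_eq : ∀ e : Fin 3 → ℤˣ,
    ∃ a, ∀ j, (e j : ℤ) = (∏ l, e l : ℤˣ) * vertexSign a j := by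
  decide +kernel

theorem prod_vertexSign : ∀ a, ∏ j, vertexSign a j = 1 := by
  decide

theorem exists_vertexSign_add_eq : ∀ a b, a ≠ b → ∃ (j : Fin 3) (e : ℤˣ),
    ∀ l, vertexSign a l + vertexSign b l = 2 * e * (Pi.single j 1 : Fin 3 → ℤ) l := by
  decide +kernel

theorem exists_ne_vertexSign_add_eq : ∀ (j : Fin 3) (e : ℤˣ), ∃ a b, a ≠ b ∧
    ∀ l, vertexSign a l + vertexSign b l = 2 * e * (Pi.single j 1 : Fin 3 → ℤ) l := by
  decide +kernel

variable {k : Type*} [Field k]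

theorem units_cast_mul_self (e : ℤˣ) : ((e : ℤ) : k) * (e : ℤ) = 1 := by
  rw [← Int.cast_mul, Int.units_coe_mul_self, Int.cast_one]

theorem units_cast_ne_zero (e : ℤˣ) : ((e : ℤ) : k) ≠ 0 :=
  left_ne_zero_of_mul_eq_one (units_cast_mul_self e)

theorem exists_units_cast_eq {c : k} (h : c ^ 2 = 1) : ∃ e : ℤˣ, ((e : ℤ) : k) = c := by
  rcases sq_eq_one_iff.mp h with rfl | rfl
  · exact ⟨1, by simp⟩
  · exact ⟨-1, by simp⟩

theorem prod_vertex (a : Fin 4) : ∏ j, vertex k a j = 1 := by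
  simp only [vertex]
  rw [← Int.cast_prod, prod_vertexSign, Int.cast_one]

theorem exists_eq_prod_smul_vertex {x : Fin 3 → k} (hx : ∀ j, x j ^ 2 = 1) :
    ∃ a, x = (∏ j, x j) • vertex k a := by
  choose e he using fun j => exists_units_cast_eq (hx j)
  obtain ⟨a, ha⟩ := exists_vertexSign_eq e
  refine ⟨a, funext fun j => ?_⟩
  rw [← he, ha]
  simp [vertex, ← he]

theorem vertex_add_vertex {a b : Fin 4} {j : Fin 3} {e : ℤˣ} (h : ∀ l, vertexSign a l +
    vertexSign b l = 2 * e * (Pi.single j 1 : Fin 3 → ℤ) l) :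
    vertex k a + vertex k b = (2 * (e : ℤ) : k) • Pi.single j 1 := by
  ext l
  have hl := congrArg (Int.cast : ℤ → k) (h l)
  simpa [vertex, Pi.single_apply] using hl

theorem smul_sumElim {α β : Type*} (c : k) (x : α → k) (y : β → k) :
    c • Sum.elim x y = Sum.elim (c • x) (c • y) :=
  Sum.comp_elim (c • ·) x y

variable {i : k} (hi : i ^ 2 = -1)

include hi in
theorem ne_zero_of_sq_eq_neg_one : i ≠ 0 := by
  rintro rfl
  simp at hi

/-- The point of `ℙ⁵` given by a pair of vertices; these points make up `sing₂`. -/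
def vertexPoint (ab : Fin 4 × Fin 4) : ℙ k (KIdx → k) :=
  point hi (vertex k ab.1, vertex k ab.2) fun h => vertex_ne_zero ab.1 (congrArg Prod.fst h)

/-- The point of `ℙ⁵` given by a pair of coordinate axes and a relative sign; these points make
up `sing₁`. -/
def axisPoint (t : Fin 3 × Fin 3 × ℤˣ) : ℙ k (KIdx → k) :=
  point hi (Pi.single t.1 1, ((t.2.2 : ℤ) : k) • Pi.single t.2.1 1) fun h => by
    simpa using congrFun (congrArg Prod.fst h) t.1

theorem vertexPoint_submodule (a b : Fin 4) : (vertexPoint hi (a, b)).submodule =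
    Submodule.span k {Sum.elim (i • vertex k a) (vertex k b)} := by
  rw [vertexPoint, point_submodule, kleinEquiv_apply,
    ← Submodule.span_singleton_smul_eq (isUnit_iff_ne_zero.mpr (ne_zero_of_sq_eq_neg_one hi)),
    smul_sumElim, smul_smul, show i * -i = 1 by linear_combination -hi, one_smul]

theorem axisPoint_submodule (j l : Fin 3) (e : ℤˣ) : (axisPoint hi (j, l, e)).submodule =
    Submodule.span k {Sum.elim (Pi.single j 1) (Pi.single l (-i * (e : ℤ)))} := by
  rw [axisPoint, point_submodule, kleinEquiv_apply]
  simp only [← Pi.single_smul, smul_eq_mul, mul_one]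

theorem sing₁_eq_range : sing₁ k = Set.range (axisPoint hi) := by
  ext P
  constructor
  · rintro ⟨j, l, c, hc, hP⟩
    obtain ⟨e, he⟩ := exists_units_cast_eq (c := i * c) (by linear_combination i ^ 2 * hc - hi)
    refine ⟨(j, l, e), Projectivization.submodule_injective ?_⟩
    rw [axisPoint_submodule, hP, he, show -i * (i * c) = c by linear_combination -c * hi]
  · rintro ⟨⟨j, l, e⟩, rfl⟩
    refine ⟨j, l, -i * (e : ℤ), ?_, axisPoint_submodule hi j l e⟩
    linear_combination i ^ 2 * units_cast_mul_self (k := k) e + hi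

theorem sing₂_eq_range : sing₂ i = Set.range (vertexPoint hi) := by
  ext P
  constructor
  · rintro ⟨ε, e, hε, he, hprod, hP⟩
    obtain ⟨a, ha⟩ := exists_eq_prod_smul_vertex (x := -i • ε) fun j => by
      rw [Pi.smul_apply, smul_eq_mul]
      linear_combination i ^ 2 * hε j - hi
    obtain ⟨b, hb⟩ := exists_eq_prod_smul_vertex he
    have hprod' : ∏ j, (-i • ε) j = ∏ j, e j := by
      simp only [Fin.prod_univ_three, Pi.smul_apply, smul_eq_mul]
      linear_combination -i ^ 3 * hprod + e 0 * e 1 * e 2 * (i ^ 2 - 1) * hi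
    have hunit : ∏ j, e j ≠ 0 := Finset.prod_ne_zero_iff.mpr fun j _ h => by simpa [h] using he j
    have hεa : ε = (∏ j, e j) • i • vertex k a := by
      rw [smul_comm, ← hprod', ← ha, smul_smul, show i * -i = 1 by linear_combination -hi, one_smul]
    refine ⟨(a, b), Projectivization.submodule_injective ?_⟩
    rw [vertexPoint_submodule, hP,
      ← Submodule.span_singleton_smul_eq (isUnit_iff_ne_zero.mpr hunit), smul_sumElim, ← hεa, ← hb]
  · rintro ⟨⟨a, b⟩, rfl⟩
    have hsq (a : Fin 4) (j : Fin 3) : vertex k a j ^ 2 = 1 :=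
      (sq _).trans (vertex_apply_mul_self a j)
    have hprod (a : Fin 4) : vertex k a 0 * vertex k a 1 * vertex k a 2 = 1 :=
      (Fin.prod_univ_three _).symm.trans (prod_vertex a)
    refine ⟨i • vertex k a, vertex k b, fun j => ?_, hsq b, ?_, vertexPoint_submodule hi a b⟩
    · rw [Pi.smul_apply, smul_eq_mul, mul_pow, hi, hsq, mul_one]
    · simp only [Pi.smul_apply, smul_eq_mul]
      linear_combination i ^ 3 * hprod a + i * hprod b + i * hi

include hi in
theorem disjoint_sing : Disjoint (sing₁ k) (sing₂ i) := by
  rw [sing₁_eq_range hi, sing₂_eq_range hi, Set.disjoint_range_iff]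
  rintro ⟨j, l, e⟩ ⟨a, b⟩ h
  obtain ⟨c, hc⟩ := (point_eq_point_iff hi).mp h
  obtain ⟨m, hm⟩ := exists_ne j
  have h0 : c • vertex k a = Pi.single j 1 := congrArg Prod.fst hc
  have hcm : c * vertex k a m = 0 := (congrFun h0 m).trans (Pi.single_eq_of_ne hm 1)
  have hc0 : c = 0 := by
    linear_combination vertex k a m * hcm - c * vertex_apply_mul_self (k := k) a m
  simpa [hc0] using congrFun h0 j

theorem exists_eq_single_of_cofactors_eq_zero {x : Fin 3 → k} (h : cofactors x = 0) :
    ∃ j, x = x j • Pi.single j 1 := by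
  have h0 : x 1 * x 2 = 0 := congrFun h 0
  have h1 : x 0 * x 2 = 0 := congrFun h 1
  have h2 : x 0 * x 1 = 0 := congrFun h 2
  by_cases hx : x 0 = 0
  · rcases mul_eq_zero.mp h0 with h | h
    · exact ⟨2, by ext l; fin_cases l <;> simp [hx, h]⟩
    · exact ⟨1, by ext l; fin_cases l <;> simp [hx, h]⟩
  · refine ⟨0, ?_⟩
    ext l
    fin_cases l <;> simp [(mul_eq_zero.mp h1).resolve_left hx, (mul_eq_zero.mp h2).resolve_left hx]

theorem mul_mul_self_eq_prod_of_cofactors_eq {x : Fin 3 → k} {c : k} (h : cofactors x = c • x)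
    (j : Fin 3) : c * (x j * x j) = ∏ l, x l := by
  have hj : cofactors x j = c * x j := congrFun h j
  rw [← mul_assoc, ← hj, Fin.prod_univ_three]
  fin_cases j <;> simp [cofactors] <;> ring

theorem prod_eq_pow_of_cofactors_eq {x : Fin 3 → k} {c : k} (hx : ∏ j, x j ≠ 0)
    (h : cofactors x = c • x) : ∏ j, x j = c ^ 3 := by
  have hprod := Fintype.prod_congr _ _ (mul_mul_self_eq_prod_of_cofactors_eq h)
  simp only [Finset.prod_mul_distrib, Finset.prod_const, Finset.card_univ, Fintype.card_fin]
    at hprod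
  exact mul_right_cancel₀ (mul_ne_zero hx hx) (by linear_combination -hprod)

theorem exists_eq_smul_vertex_of_cofactors_eq {x : Fin 3 → k} {c : k} (hc : c ≠ 0)
    (hx : ∏ j, x j ≠ 0) (h : cofactors x = c • x) : ∃ a, x = c • vertex k a := by
  have hprod := prod_eq_pow_of_cofactors_eq hx h
  obtain ⟨a, ha⟩ := exists_eq_prod_smul_vertex (x := c⁻¹ • x) fun j => by
    have hsq := mul_mul_self_eq_prod_of_cofactors_eq h j
    rw [Pi.smul_apply, smul_eq_mul]
    field_simp
    exact mul_left_cancel₀ hc (by linear_combination hsq + hprod)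
  refine ⟨a, (inv_smul_eq_iff₀ hc).mp (ha.trans ?_)⟩
  simp [Finset.prod_mul_distrib, hprod, hc]

theorem mem_sing₁_of_cofactors_eq_zero {p : Pair k} {hp : p ≠ 0} (hH : HumbertEqs p)
    (h₁ : cofactors p.1 = 0) (h₂ : cofactors p.2 = 0) : point hi p hp ∈ sing₁ k := by
  obtain ⟨j, hj⟩ := exists_eq_single_of_cofactors_eq_zero h₁
  obtain ⟨l, hl⟩ := exists_eq_single_of_cofactors_eq_zero h₂
  have hsq := hH.1
  rw [hj, hl] at hsq
  simp only [dotProduct_smul, dotProduct_single_one, Pi.smul_apply, Pi.single_eq_same,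
    smul_eq_mul, mul_one] at hsq
  have hpj : p.1 j ≠ 0 := fun h => hp (by
    rw [h, zero_mul, eq_comm, mul_self_eq_zero] at hsq
    rw [← Prod.mk.eta (p := p), hj, hl, h, hsq]
    simp)
  obtain ⟨e, he⟩ := exists_units_cast_eq (c := p.2 l / p.1 j) (by
    rw [div_pow, sq, sq, ← hsq, div_self (mul_ne_zero hpj hpj)])
  rw [sing₁_eq_range hi]
  refine ⟨(j, l, e), eq_comm.mp ((point_eq_point_iff hi).mpr ⟨p.1 j, ?_⟩)⟩
  refine Prod.ext hj.symm ?_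
  rw [Prod.smul_snd, he, smul_smul, mul_div_cancel₀ _ hpj, ← hl]

theorem mem_sing₂_of_cofactors_eq_smul {p : Pair k} {hp : p ≠ 0} (hH : HumbertEqs p) {c : k}
    (hc : c ≠ 0) (h₁ : cofactors p.1 = c • p.1) (h₂ : cofactors p.2 = c • p.2) :
    point hi p hp ∈ sing₂ i := by
  have hprod : ∏ j, p.1 j ≠ 0 := fun h0 => hp (by
    have hzero {x : Fin 3 → k} (h : cofactors x = c • x) (hx : ∏ j, x j = 0) : x = 0 :=
      funext fun j => by simpa [hc, hx] using mul_mul_self_eq_prod_of_cofactors_eq h j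
    exact Prod.ext (hzero h₁ h0) (hzero h₂ (hH.2 ▸ h0)))
  obtain ⟨a, ha⟩ := exists_eq_smul_vertex_of_cofactors_eq hc hprod h₁
  obtain ⟨b, hb⟩ := exists_eq_smul_vertex_of_cofactors_eq hc (hH.2 ▸ hprod) h₂
  rw [sing₂_eq_range hi]
  exact ⟨(a, b), ((point_eq_point_iff hi).mpr ⟨c, Prod.ext ha.symm hb.symm⟩).symm⟩

variable [NeZero (2 : k)]

theorem edge_pair_ne_zero {a b : Fin 4} (hab : a ≠ b) (z : Fin 3 → k) :
    ((vertex k a + vertex k b, z) : Pair k) ≠ 0 := fun h => by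
  have h1 : (1 : k) • vertex k a = (-1 : k) • vertex k b := by
    rw [one_smul, neg_one_smul]
    exact eq_neg_of_add_eq_zero_left (congrArg Prod.fst h)
  exact one_ne_zero (eq_zero_of_smul_vertex_eq_smul_vertex hab h1)

theorem mem_sing₁_iff_edge {P : ℙ k (KIdx → k)} :
    P ∈ sing₁ k ↔ ∃ (a b c d : Fin 4) (hab : a ≠ b) (_ : c ≠ d),
      P = point hi (vertex k a + vertex k b, vertex k c + vertex k d)
        (edge_pair_ne_zero hab _) := by
  rw [sing₁_eq_range hi]
  constructor
  · rintro ⟨⟨j, l, e⟩, rfl⟩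
    obtain ⟨a, b, hab, h1⟩ := exists_ne_vertexSign_add_eq j 1
    obtain ⟨c, d, hcd, h2⟩ := exists_ne_vertexSign_add_eq l e
    refine ⟨a, b, c, d, hab, hcd, (point_eq_point_iff hi).mpr ⟨2⁻¹, ?_⟩⟩
    rw [vertex_add_vertex h1, vertex_add_vertex h2]
    simp [mul_smul, inv_smul_smul₀ (two_ne_zero (α := k))]
  · rintro ⟨a, b, c, d, hab, hcd, rfl⟩
    obtain ⟨j, e, h1⟩ := exists_vertexSign_add_eq a b hab
    obtain ⟨l, e', h2⟩ := exists_vertexSign_add_eq c d hcd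
    refine ⟨(j, l, e * e'), ((point_eq_point_iff hi).mpr ⟨2 * (e : ℤ), ?_⟩).symm⟩
    rw [vertex_add_vertex h1, vertex_add_vertex h2, Prod.smul_mk, smul_smul, Units.val_mul,
      Int.cast_mul, mul_assoc, ← mul_assoc ((e : ℤ) : k), units_cast_mul_self, one_mul]

include hi in
theorem sing₁_subset_singularPoints [Infinite k] :
    sing₁ k ⊆ singularPoints 3 (humbertComplex i) := by
  intro P hP
  obtain ⟨a, b, c, d, hab, hcd, rfl⟩ := (mem_sing₁_iff_edge hi).mp hP
  obtain ⟨s, rfl, rfl⟩ := exists_perm_map_pair_iff.mpr (iff_of_false hab hcd)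
  have hne : ∀ a b : Fin 4, a ≠ b → ∃ c d, a ≠ c ∧ a ≠ d ∧ b ≠ c ∧ b ≠ d ∧ c ≠ d := by decide
  obtain ⟨x, y, hax, hay, hbx, hby, hxy⟩ := hne a b hab
  have hmem {t : Perm (Fin 4)} (h : vertex k (t a) + vertex k (t b) =
      vertex k (s a) + vertex k (s b)) : (vertex k a + vertex k b,
      vertex k (s a) + vertex k (s b)) ∈ graphPlane k t := by
    rw [mem_graphPlane, Matrix.mulVec_add, tet_mulVec_vertex, tet_mulVec_vertex, h]
  refine point_mem_singularPoints hi _ hab hax hay hxy (hmem rfl) (hmem ?_) (hmem ?_)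
  · simp [add_comm]
  · simp [swap_apply_of_ne_of_ne, hax, hay, hbx, hby]

include hi in
theorem sing₂_subset_singularPoints [Infinite k] :
    sing₂ i ⊆ singularPoints 3 (humbertComplex i) := by
  rw [sing₂_eq_range hi, Set.range_subset_iff]
  rintro ⟨a, b⟩
  have hne : ∀ a : Fin 4, ∃ x y z, a ≠ x ∧ a ≠ y ∧ a ≠ z ∧ x ≠ y ∧ x ≠ z ∧ y ≠ z := by decide
  obtain ⟨x, y, z, hax, hay, haz, hxy, hxz, hyz⟩ := hne a
  exact point_mem_singularPoints hi _ hxy hxy hxz hyz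
    (s := swap a b) (vertex_pair_mem_graphPlane.mpr (swap_apply_left a b))
    (vertex_pair_mem_graphPlane.mpr (by simp [swap_apply_of_ne_of_ne hax hay]))
    (vertex_pair_mem_graphPlane.mpr (by simp [swap_apply_of_ne_of_ne hay haz]))

include hi in
theorem singularPoints_humbertComplex [Infinite k] :
    singularPoints 3 (humbertComplex i) = sing₁ k ∪ sing₂ i := by
  refine Set.Subset.antisymm (fun P hP => ?_) (Set.union_subset (sing₁_subset_singularPoints hi)
    (sing₂_subset_singularPoints hi))
  obtain ⟨p, hp, c, rfl, hH, h₁, h₂⟩ := exists_cofactors_eq_smul hi hP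
  by_cases hc : c = 0
  · exact Or.inl (mem_sing₁_of_cofactors_eq_zero hi hH (by simpa [hc] using h₁)
      (by simpa [hc] using h₂))
  · exact Or.inr (mem_sing₂_of_cofactors_eq_smul hi hH hc h₁ h₂)

theorem units_cast_injective : Function.Injective fun e : ℤˣ => ((e : ℤ) : k) := by
  have hne : (-1 : k) ≠ 1 := fun h => two_ne_zero (α := k) (by linear_combination -h)
  intro e e' h
  rcases Int.units_eq_one_or e with rfl | rfl <;> rcases Int.units_eq_one_or e' with rfl | rfl <;>
    simp_all [eq_comm]

theorem axisPoint_injective : Function.Injective (axisPoint hi) := by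
  rintro ⟨j, l, e⟩ ⟨j', l', e'⟩ h
  obtain ⟨c, hc⟩ := (point_eq_point_iff hi).mp h
  obtain ⟨h1, h2⟩ := Prod.ext_iff.mp hc
  simp only [Prod.smul_fst, Prod.smul_snd, ← Pi.single_smul, smul_eq_mul, mul_one] at h1 h2
  obtain rfl : j = j' := by
    by_contra hj
    simpa [Pi.single_eq_of_ne hj] using congrFun h1 j
  obtain rfl : c = 1 := Pi.single_injective j h1
  obtain rfl : l = l' := by
    by_contra hl
    simpa [Pi.single_eq_of_ne hl, eq_comm, units_cast_ne_zero] using congrFun h2 l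
  have he : ((e' : ℤ) : k) = (e : ℤ) := by simpa using Pi.single_injective l h2
  rw [units_cast_injective he]

theorem vertexPoint_injective : Function.Injective (vertexPoint hi) := by
  rintro ⟨a, b⟩ ⟨a', b'⟩ h
  obtain ⟨c, hc⟩ := (point_eq_point_iff hi).mp h
  have key {a a' : Fin 4} (h : c • vertex k a' = vertex k a) : a = a' := by
    by_contra hne
    exact one_ne_zero (eq_zero_of_smul_vertex_eq_smul_vertex hne ((one_smul k _).trans h.symm))
  exact Prod.ext (key (congrArg Prod.fst hc)) (key (congrArg Prod.snd hc))

include hi in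
theorem ncard_sing₁ : (sing₁ k).ncard = 18 := by
  rw [sing₁_eq_range hi, Set.ncard_range_of_injective (axisPoint_injective hi)]
  simp

include hi in
theorem ncard_sing₂ : (sing₂ i).ncard = 16 := by
  rw [sing₂_eq_range hi, Set.ncard_range_of_injective (vertexPoint_injective hi)]
  simp

include hi in
theorem ncard_planesIn [Infinite k] : (planesIn (humbertComplex i)).ncard = 24 := by
  rw [planesIn_humbertComplex hi, Set.ncard_range_of_injective (planeSet_injective hi),
    Nat.card_perm]
  simp [Nat.factorial]

end SingularPoints

/-! ### The automorphism group and its orbits -/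

section GroupOfOrderTwo

open SemidirectProduct

/-- The homomorphism from the cyclic group of order `n` that sends the generator to an element `h`
with `h ^ n = 1`. -/
def zmodPowersHom {H : Type*} [Group H] (n : ℕ) (h : H) (hh : h ^ n = 1) :
    Multiplicative (ZMod n) →* H :=
  AddMonoidHom.toMultiplicativeLeft
    (ZMod.lift n ⟨zmultiplesHom (Additive H) (.ofMul h), by simp [← ofMul_pow, hh]⟩)

theorem zmodPowersHom_ofAdd_one {H : Type*} [Group H] {n : ℕ} {h : H} (hh : h ^ n = 1) :
    zmodPowersHom n h hh (.ofAdd 1) = h := by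
  have : ZMod.lift n ⟨zmultiplesHom (Additive H) (.ofMul h), by simp [← ofMul_pow, hh]⟩ (1 : ℤ) =
    .ofMul h := by rw [ZMod.lift_coe, zmultiplesHom_apply, one_zsmul]
  simpa [zmodPowersHom] using congrArg Additive.toMul this

theorem eq_one_or_eq_ofAdd_one : ∀ z : Multiplicative (ZMod 2), z = 1 ∨ z = .ofAdd 1 := by
  decide

theorem eq_inl_or_eq_inl_mul_inr {N : Type*} [Group N]
    {φ : Multiplicative (ZMod 2) →* MulAut N} (a : N ⋊[φ] Multiplicative (ZMod 2)) :
    ∃ n, a = inl n ∨ a = inl n * inr (.ofAdd 1) := by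
  obtain ⟨n, z⟩ := a
  rcases eq_one_or_eq_ofAdd_one z with rfl | rfl
  · exact ⟨n, Or.inl rfl⟩
  · exact ⟨n, Or.inr (mk_eq_inl_mul_inr _ n)⟩

end GroupOfOrderTwo

section Automorphisms

open Equiv (Perm)
open Matrix.ProjGenLinGroup

/-- The abstract group of symmetries: two copies of the symmetric group on four letters, together
with the interchange of the two. -/
abbrev HumbertGroup : Type :=
  (Perm (Fin 4) × Perm (Fin 4)) ⋊[swapAction (Perm (Fin 4))] Multiplicative (ZMod 2)

variable {k : Type*} [Field k]

theorem mk_g₀_sq : mk (g₀ k) ^ 2 = 1 := by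
  rw [sq, ← map_mul, ← map_one mk, mk_eq_mk_iff_exists_smul]
  refine ⟨-1, fun v => ?_⟩
  rw [mul_smul, one_smul, ← Sum.elim_comp_inl_inr v, g₀_smul, g₀_smul, smul_sumElim]
  simp

variable [NeZero (2 : k)]

theorem mk_g₀_mul_mk_tetBlock (n : Perm (Fin 4) × Perm (Fin 4)) :
    mk (g₀ k) * mk (tetBlock k n) = mk (tetBlock k n.swap) * mk (g₀ k) := by
  rw [← map_mul, ← map_mul]
  refine congrArg _ (generalLinearGroup_ext fun v => ?_)
  rw [← Sum.elim_comp_inl_inr v]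
  simp only [mul_smul, tetBlock_smul, g₀_smul, Prod.fst_swap, Prod.snd_swap, Matrix.mulVec_neg]

/-- The action of the abstract group of symmetries on `ℙ⁵`. -/
def humbertHom (k : Type*) [Field k] [NeZero (2 : k)] : HumbertGroup →* PGL(KIdx, k) :=
  SemidirectProduct.lift (mk.comp (tetBlock k)) (zmodPowersHom 2 (mk (g₀ k)) mk_g₀_sq) fun z => by
    ext1 n
    rcases eq_one_or_eq_ofAdd_one z with rfl | rfl
    · simp
    · change mk (tetBlock k n.swap) = zmodPowersHom 2 (mk (g₀ k)) mk_g₀_sq (.ofAdd 1) *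
        mk (tetBlock k n) * (zmodPowersHom 2 (mk (g₀ k)) mk_g₀_sq (.ofAdd 1))⁻¹
      rw [zmodPowersHom_ofAdd_one, mk_g₀_mul_mk_tetBlock, mul_inv_cancel_right]

theorem humbertHom_inl (n : Perm (Fin 4) × Perm (Fin 4)) :
    humbertHom k (SemidirectProduct.inl n) = mk (tetBlock k n) :=
  SemidirectProduct.lift_inl _ _ _ n

theorem humbertHom_inr :
    humbertHom k (SemidirectProduct.inr (.ofAdd 1)) = mk (g₀ k) :=
  (SemidirectProduct.lift_inr _ _ _ _).trans (zmodPowersHom_ofAdd_one _)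

theorem humbertEqs_tetProd_iff {s t : Perm (Fin 4)} {p : Pair k} :
    HumbertEqs (tetProd k s t p) ↔ HumbertEqs p := by
  simp only [HumbertEqs, tetProd_apply, tet_mulVec_dotProduct_tet_mulVec, prod_tet_mulVec]

variable {i : k} (hi : i ^ 2 = -1)

include hi in
theorem mk_tetBlock_mem (n : Perm (Fin 4) × Perm (Fin 4)) :
    mk (tetBlock k n) ∈ projectiveAut (humbertComplex i) :=
  (mk_mem_projectiveAut_iff hi).mpr fun p => by
    rw [pairMap_tetBlock, humbertEqs_tetProd_iff]

include hi in
theorem mk_g₀_mem : mk (g₀ k) ∈ projectiveAut (humbertComplex i) := by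
  refine (mk_mem_projectiveAut_iff hi).mpr fun p => ?_
  have hswap : HumbertEqs p.swap ↔ HumbertEqs p := and_congr eq_comm eq_comm
  rw [pairMap_g₀, ← hswap]
  refine ⟨fun h => ?_, fun h => h.smul i⟩
  simpa [inv_smul_smul₀ (ne_zero_of_sq_eq_neg_one hi)] using h.smul i⁻¹

include hi in
theorem humbertHom_mem (a : HumbertGroup) :
    humbertHom k a ∈ projectiveAut (humbertComplex i) := by
  obtain ⟨n, rfl | rfl⟩ := eq_inl_or_eq_inl_mul_inr a
  · rw [humbertHom_inl]
    exact mk_tetBlock_mem hi n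
  · rw [map_mul, humbertHom_inl, humbertHom_inr]
    exact mul_mem (mk_tetBlock_mem hi n) (mk_g₀_mem hi)

include hi in
theorem humbertHom_injective : Function.Injective (humbertHom k) := by
  rw [injective_iff_map_eq_one]
  intro a ha
  obtain ⟨n, rfl | rfl⟩ := eq_inl_or_eq_inl_mul_inr a
  · rw [humbertHom_inl, ← map_one mk, mk_eq_mk_iff_pairMap hi] at ha
    obtain ⟨c, hc⟩ := ha
    have h (a : Fin 4) : vertex k (n.1 a) = c • vertex k a ∧ vertex k (n.2 a) = c • vertex k a := by
      simpa [pairMap_tetBlock, tetProd_apply] using hc (vertex k a, vertex k a)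
    have key {a b : Fin 4} (h : vertex k b = c • vertex k a) : b = a := by
      by_contra hba
      exact one_ne_zero (eq_zero_of_smul_vertex_eq_smul_vertex hba ((one_smul k _).trans h))
    rw [show n = 1 from Prod.ext (Equiv.ext fun a => key (h a).1)
      (Equiv.ext fun a => key (h a).2), map_one]
  · rw [map_mul, humbertHom_inl, humbertHom_inr, ← map_mul, ← map_one mk,
      mk_eq_mk_iff_pairMap hi] at ha
    obtain ⟨c, hc⟩ := ha
    have h := congrArg Prod.snd (hc (vertex k 0, 0))
    simp [pairMap_g₀, pairMap_tetBlock, tetProd_apply, Matrix.mulVec_smul, vertex_ne_zero,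
      ne_zero_of_sq_eq_neg_one hi] at h

include hi in
theorem exists_humbertHom_eq [Infinite k] {γ : PGL(KIdx, k)}
    (hγ : γ ∈ projectiveAut (humbertComplex i)) : ∃ a, humbertHom k a = γ := by
  obtain ⟨g, rfl⟩ := mk_surjective γ
  obtain ⟨c, s, t, h | h⟩ := exists_pairMap_eq hi hγ
  · refine ⟨SemidirectProduct.inl (s, t), ?_⟩
    rw [humbertHom_inl, eq_comm, mk_eq_mk_iff_pairMap hi]
    exact ⟨c, fun p => by rw [h, pairMap_tetBlock]⟩
  · refine ⟨SemidirectProduct.inl (s, t) * SemidirectProduct.inr (.ofAdd 1), ?_⟩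
    rw [map_mul, humbertHom_inl, humbertHom_inr, ← map_mul, eq_comm, mk_eq_mk_iff_pairMap hi]
    refine ⟨c * i⁻¹, fun p => ?_⟩
    rw [h, map_mul, LinearEquiv.mul_apply, pairMap_g₀, pairMap_tetBlock, map_smul, mul_smul,
      inv_smul_smul₀ (ne_zero_of_sq_eq_neg_one hi)]

/-- The isomorphism of the abstract group of symmetries with the group of projective automorphisms
of the Humbert complex. -/
noncomputable def humbertEquiv [Infinite k] : HumbertGroup ≃* projectiveAut (humbertComplex i) :=
  MulEquiv.ofBijective ((humbertHom k).codRestrict _ (humbertHom_mem hi))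
    ⟨fun _ _ h => humbertHom_injective hi (congrArg Subtype.val h), fun γ =>
      (exists_humbertHom_eq hi γ.2).imp fun _ ha => Subtype.ext ha⟩

theorem coe_humbertEquiv [Infinite k] (a : HumbertGroup) :
    (humbertEquiv hi a : PGL(KIdx, k)) = humbertHom k a := rfl

include hi in
theorem orderOf_mk_g₀ : orderOf (mk (g₀ k)) = 2 := by
  refine orderOf_eq_prime mk_g₀_sq fun h => ?_
  rw [← humbertHom_inr, ← map_one (humbertHom k)] at h
  have hinr := SemidirectProduct.inr_injective
    ((humbertHom_injective hi h).trans (map_one SemidirectProduct.inr).symm)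
  exact absurd hinr (by decide)

end Automorphisms

section Orbits

open Equiv (Perm swap swap_apply_left)
open Matrix.ProjGenLinGroup

variable {k : Type*} [Field k] [NeZero (2 : k)] {i : k} (hi : i ^ 2 = -1)

include hi in
theorem orbit_projectiveAut_eq [Infinite k] {α : Type*} [MulAction PGL(KIdx, k) α] {S : Set α}
    (htet : ∀ n, ∀ a ∈ S, mk (tetBlock k n) • a ∈ S) (hg₀ : ∀ a ∈ S, mk (g₀ k) • a ∈ S)
    (htrans : ∀ a ∈ S, ∀ b ∈ S, ∃ n, mk (tetBlock k n) • a = b) {a : α} (ha : a ∈ S) :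
    MulAction.orbit (projectiveAut (humbertComplex i)) a = S := by
  ext b
  constructor
  · rintro ⟨⟨γ, hγ⟩, rfl⟩
    obtain ⟨x, rfl⟩ := exists_humbertHom_eq hi hγ
    change humbertHom k x • a ∈ S
    obtain ⟨n, rfl | rfl⟩ := eq_inl_or_eq_inl_mul_inr x
    · rw [humbertHom_inl]
      exact htet n a ha
    · rw [map_mul, humbertHom_inl, humbertHom_inr, mul_smul]
      exact htet n _ (hg₀ a ha)
  · intro hb
    obtain ⟨n, rfl⟩ := htrans a ha b hb
    exact ⟨⟨_, mk_tetBlock_mem hi n⟩, rfl⟩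

theorem mk_tetBlock_smul_point {n : Perm (Fin 4) × Perm (Fin 4)} {p q : Pair k} {hp : p ≠ 0}
    {hq : q ≠ 0} (h : tetProd k n.1 n.2 p = q) :
    mk (tetBlock k n) • point hi p hp = point hi q hq := by
  rw [mk_smul_point, point_eq_point_iff]
  exact ⟨1, by rw [pairMap_tetBlock, h, one_smul]⟩

omit [NeZero (2 : k)] in
theorem mk_g₀_smul_point {x z : Fin 3 → k} {h : (x, z) ≠ 0} {h' : (z, x) ≠ 0} :
    mk (g₀ k) • point hi (x, z) h = point hi (z, x) h' := by
  rw [mk_smul_point, point_eq_point_iff]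
  exact ⟨i, (pairMap_g₀ hi (x, z)).symm⟩

theorem tetProd_edge_pair (s t : Perm (Fin 4)) (a b c d : Fin 4) :
    tetProd k s t (vertex k a + vertex k b, vertex k c + vertex k d) =
      (vertex k (s a) + vertex k (s b), vertex k (t c) + vertex k (t d)) := by
  simp [tetProd_apply, Matrix.mulVec_add]

theorem tetProd_vertex_pair (s t : Perm (Fin 4)) (a b : Fin 4) :
    tetProd k s t (vertex k a, vertex k b) = (vertex k (s a), vertex k (t b)) := by
  simp [tetProd_apply]

theorem mk_tetBlock_smul_planeSet (n : Perm (Fin 4) × Perm (Fin 4)) (r : Perm (Fin 4)) :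
    mk (tetBlock k n) • planeSet hi r = planeSet hi (n.2 * r * n.1⁻¹) :=
  mk_smul_planeSet hi fun p => by
    rw [pairMap_tetBlock, mem_graphPlane, mem_graphPlane, tetProd_apply,
      ← eq_tet_inv_mulVec_iff, tet_mulVec_mulVec, tet_mulVec_mulVec]
    simp only [mul_assoc, inv_mul_cancel, mul_one, inv_mul_cancel_left]

theorem mk_g₀_smul_planeSet (r : Perm (Fin 4)) :
    mk (g₀ k) • planeSet hi r = planeSet hi r⁻¹ :=
  mk_smul_planeSet hi fun p => by
    rw [pairMap_g₀, Submodule.smul_mem_iff _ (ne_zero_of_sq_eq_neg_one hi), mem_graphPlane,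
      mem_graphPlane, Prod.snd_swap, Prod.fst_swap, eq_tet_inv_mulVec_iff, eq_comm]

include hi in
theorem orbit_sing₁ [Infinite k] {P : ℙ k (KIdx → k)} (hP : P ∈ sing₁ k) :
    MulAction.orbit (projectiveAut (humbertComplex i)) P = sing₁ k := by
  refine orbit_projectiveAut_eq hi ?_ ?_ ?_ hP
  · intro n P hP
    obtain ⟨a, b, c, d, hab, hcd, rfl⟩ := (mem_sing₁_iff_edge hi).mp hP
    exact (mem_sing₁_iff_edge hi).mpr ⟨n.1 a, n.1 b, n.2 c, n.2 d, n.1.injective.ne hab,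
      n.2.injective.ne hcd, mk_tetBlock_smul_point hi (tetProd_edge_pair ..)⟩
  · intro P hP
    obtain ⟨a, b, c, d, hab, hcd, rfl⟩ := (mem_sing₁_iff_edge hi).mp hP
    exact (mem_sing₁_iff_edge hi).mpr ⟨c, d, a, b, hcd, hab, mk_g₀_smul_point hi⟩
  · intro P hP Q hQ
    obtain ⟨a, b, c, d, hab, hcd, rfl⟩ := (mem_sing₁_iff_edge hi).mp hP
    obtain ⟨a', b', c', d', hab', hcd', rfl⟩ := (mem_sing₁_iff_edge hi).mp hQ
    obtain ⟨s, rfl, rfl⟩ := exists_perm_map_pair_iff.mpr (iff_of_false hab hab')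
    obtain ⟨t, rfl, rfl⟩ := exists_perm_map_pair_iff.mpr (iff_of_false hcd hcd')
    exact ⟨(s, t), mk_tetBlock_smul_point hi (tetProd_edge_pair ..)⟩

include hi in
theorem orbit_sing₂ [Infinite k] {P : ℙ k (KIdx → k)} (hP : P ∈ sing₂ i) :
    MulAction.orbit (projectiveAut (humbertComplex i)) P = sing₂ i := by
  rw [sing₂_eq_range hi] at hP ⊢
  refine orbit_projectiveAut_eq hi ?_ ?_ ?_ hP
  · rintro n _ ⟨⟨a, b⟩, rfl⟩
    exact ⟨(n.1 a, n.2 b), (mk_tetBlock_smul_point hi (tetProd_vertex_pair ..)).symm⟩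
  · rintro _ ⟨⟨a, b⟩, rfl⟩
    exact ⟨(b, a), (mk_g₀_smul_point hi).symm⟩
  · rintro _ ⟨⟨a, b⟩, rfl⟩ _ ⟨⟨a', b'⟩, rfl⟩
    refine ⟨(swap a a', swap b b'), mk_tetBlock_smul_point hi ?_⟩
    rw [tetProd_vertex_pair, swap_apply_left, swap_apply_left]

include hi in
theorem orbit_planesIn [Infinite k] {E : Set (ℙ k (KIdx → k))}
    (hE : E ∈ planesIn (humbertComplex i)) :
    MulAction.orbit (projectiveAut (humbertComplex i)) E = planesIn (humbertComplex i) := by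
  rw [planesIn_humbertComplex hi] at hE ⊢
  refine orbit_projectiveAut_eq hi ?_ ?_ ?_ hE
  · rintro n _ ⟨r, rfl⟩
    exact ⟨_, (mk_tetBlock_smul_planeSet hi n r).symm⟩
  · rintro _ ⟨r, rfl⟩
    exact ⟨_, (mk_g₀_smul_planeSet hi r).symm⟩
  · rintro _ ⟨r, rfl⟩ _ ⟨r', rfl⟩
    exact ⟨(1, r' * r⁻¹), by simp [mk_tetBlock_smul_planeSet]⟩

end Orbits

end Desmic

theorem mainTheorem2_general {k : Type*} [Field k] [Infinite k] (hp : ringChar k ≠ 2)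
    (i : k) (hi : i ^ 2 = -1) :
    (∃ φ : (Equiv.Perm (Fin 4) × Equiv.Perm (Fin 4))
          ⋊[Desmic.swapAction (Equiv.Perm (Fin 4))] Multiplicative (ZMod 2) ≃*
          Desmic.projectiveAut (Desmic.humbertComplex i),
        (φ (SemidirectProduct.inr (Multiplicative.ofAdd 1)) : PGL(Desmic.KIdx, k)) =
          Matrix.ProjGenLinGroup.mk (Desmic.g₀ k) ∧
        Set.range (fun s : Equiv.Perm (Fin 4) × Equiv.Perm (Fin 4) =>
          (φ (SemidirectProduct.inl s) : PGL(Desmic.KIdx, k))) = Desmic.obviousSymmetries k) ∧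
      orderOf (Matrix.ProjGenLinGroup.mk (Desmic.g₀ k)) = 2 ∧
      Desmic.singularPoints 3 (Desmic.humbertComplex i) = Desmic.sing₁ k ∪ Desmic.sing₂ i ∧
      Disjoint (Desmic.sing₁ k) (Desmic.sing₂ i) ∧
      (Desmic.sing₁ k).ncard = 18 ∧
      (Desmic.sing₂ i).ncard = 16 ∧
      (∀ P ∈ Desmic.sing₁ k,
        MulAction.orbit (Desmic.projectiveAut (Desmic.humbertComplex i)) P = Desmic.sing₁ k) ∧
      (∀ P ∈ Desmic.sing₂ i,
        MulAction.orbit (Desmic.projectiveAut (Desmic.humbertComplex i)) P = Desmic.sing₂ i) ∧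
      (Desmic.planesIn (Desmic.humbertComplex i)).ncard = 24 ∧
      (∀ E ∈ Desmic.planesIn (Desmic.humbertComplex i),
        MulAction.orbit (Desmic.projectiveAut (Desmic.humbertComplex i)) E =
          Desmic.planesIn (Desmic.humbertComplex i)) := by
  have : NeZero (2 : k) := ⟨Ring.two_ne_zero hp⟩
  refine ⟨⟨Desmic.humbertEquiv hi, ?_, ?_⟩, Desmic.orderOf_mk_g₀ hi,
    Desmic.singularPoints_humbertComplex hi, Desmic.disjoint_sing hi, Desmic.ncard_sing₁ hi,
    Desmic.ncard_sing₂ hi, fun P hP => Desmic.orbit_sing₁ hi hP,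
    fun P hP => Desmic.orbit_sing₂ hi hP, Desmic.ncard_planesIn hi,
    fun E hE => Desmic.orbit_planesIn hi hE⟩
  · rw [Desmic.coe_humbertEquiv, Desmic.humbertHom_inr]
  · simp only [Desmic.coe_humbertEquiv, Desmic.humbertHom_inl]
    exact Desmic.range_mk_tetBlock

theorem mainTheorem2 {k : Type*} [Field k] [IsAlgClosed k] (hp : ringChar k ≠ 2)
    (i : k) (hi : i ^ 2 = -1) :
    (∃ φ : (Equiv.Perm (Fin 4) × Equiv.Perm (Fin 4))
          ⋊[Desmic.swapAction (Equiv.Perm (Fin 4))] Multiplicative (ZMod 2) ≃*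
          Desmic.projectiveAut (Desmic.humbertComplex i),
        (φ (SemidirectProduct.inr (Multiplicative.ofAdd 1)) : PGL(Desmic.KIdx, k)) =
          Matrix.ProjGenLinGroup.mk (Desmic.g₀ k) ∧
        Set.range (fun s : Equiv.Perm (Fin 4) × Equiv.Perm (Fin 4) =>
          (φ (SemidirectProduct.inl s) : PGL(Desmic.KIdx, k))) = Desmic.obviousSymmetries k) ∧
      orderOf (Matrix.ProjGenLinGroup.mk (Desmic.g₀ k)) = 2 ∧
      Desmic.singularPoints 3 (Desmic.humbertComplex i) = Desmic.sing₁ k ∪ Desmic.sing₂ i ∧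
      Disjoint (Desmic.sing₁ k) (Desmic.sing₂ i) ∧
      (Desmic.sing₁ k).ncard = 18 ∧
      (Desmic.sing₂ i).ncard = 16 ∧
      (∀ P ∈ Desmic.sing₁ k,
        MulAction.orbit (Desmic.projectiveAut (Desmic.humbertComplex i)) P = Desmic.sing₁ k) ∧
      (∀ P ∈ Desmic.sing₂ i,
        MulAction.orbit (Desmic.projectiveAut (Desmic.humbertComplex i)) P = Desmic.sing₂ i) ∧
      (Desmic.planesIn (Desmic.humbertComplex i)).ncard = 24 ∧
      (∀ E ∈ Desmic.planesIn (Desmic.humbertComplex i),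
        MulAction.orbit (Desmic.projectiveAut (Desmic.humbertComplex i)) E =
          Desmic.planesIn (Desmic.humbertComplex i)) := by
  have : Infinite k := IsAlgClosed.instInfinite
  exact mainTheorem2_general hp i hi
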